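/- **Setting.** Let $G=(X,w,\kappa,\mu)$ be a weighted graph: $X$ is a countable set, $w:X\times X\to[0,\infty)$ is symmetric with $w(x,x)=0$ and $\sum_{y}w(x,y)<\infty$ for every $x$, $\kappa:X\to[0,\infty)$ and $\mu:X\to(0,\infty)$. Let $\ell^p=\ell^p(X,\mu)$ with norm $\|u\|_p=(\sum_x|u(x)|^p\mu(x))^{1/p}$, and let $$\Delta u(x)=\frac1{\mu(x)}\sum_{y\in X}w(x,y)\,(u(x)-u(y))+\frac{\kappa(x)}{\mu(x)}u(x),\qquad \operatorname{dom}(\Delta)=\Big\{u:\ \sum_{y}w(x,y)|u(y)|<\infty\ \ \forall x\Big\}.$$ Put $\mathcal A=\Delta+\operatorname{id}$ with $\operatorname{dom}_p(\mathcal A)=\{u\in\ell^p\cap\operatorname{dom}(\Delta):\mathcal Au\in\ell^p\}$. Let $X_1\subseteq X_2\subseteq\dots$ be finite sets with union $X$. Let $\mathcal A_n$ be the operator that restricts a function to $X_n$, applies $\Delta_{\mathrm{dir},n}+\operatorname{id}$ and extends by $0$, where $\Delta_{\mathrm{dir},n}$ is the Laplacian of the finite graph with node set $X_n$, the restrictions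 of $w$ and $\mu$, and killing term $\kappa(x)+\sum_{y\notin X_n}w(x,y)$. Let $\Omega_p$ be the set of $u\in\operatorname{dom}_p(\mathcal A)$ for which there are $u_n$ with $\operatorname{supp}u_n\subseteq X_n$, $\|u_n-u\|_p\to0$ and $\|\mathcal A_nu_n-\mathcal Au\|_p\to0$. For an operator $A$ in $\ell^p$, $u_0\in\ell^p$, $0<T<\infty$ and $h\in L^1([0,T];\ell^p)$, a *mild solution* of $\partial_tu+Au=h$, $u(0)=u_0$ on $[0,T]$ is a function $u\in C([0,T];\ell^p)$ such that for every $\epsilon>0$ there are $0=t_0<\dots<t_N\le T$, $h_1,\dots,h_N\in\ell^p$ and $u_1,\dots,u_N\in\operatorname{dom}(A)$ with $t_k-t_{k-1}\le\epsilon$, $T-t_N\le\epsilon$, $\sum_k\int_{t_{k-1}}^{t_k}\|h(t)-h_k\|_p\,dt\le\epsilon$, $u_k+(t_k-t_{k-1})Au_k=u_{k-1}+(t_k-t_{k-1})h_k$ for $k=1,\dots,N$, and $\|u(0)-u_0\|_p<\epsilon$, $\|u(t)-u_k\|_p<\epsilon$ for $t\in(t_{k-1},t_k]$. For $T=\infty$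 the interval is $[0,\infty)$, and $u$ is mild if its restriction to each $[0,a]$ is. **Proposition (linear case $f(u)=-u$).** Let $1\le p<\infty$ and, if $p>1$, assume $\sum_{y}w(x,y)^p\mu(y)^{1-p}<\infty$ for every $x\in X$. Then $-\mathcal A|_{\Omega_p}$ is the infinitesimal generator of a strongly continuous semigroup $e^{-t(\Delta+\operatorname{id})}$, $t\ge0$, of bounded operators on $\ell^p$. For all $0<T\le\infty$, $u_0\in\ell^p$ and $h\in L^1_{\mathrm{loc}}([0,T];\ell^p)$, the problem $$\partial_tu+\Delta u+u=h,\qquad u(0)=u_0,$$ understood with the operator $\mathcal A|_{\Omega_p}$, has a unique mild solution $u$ on $[0,T]$ (on $[0,\infty)$ if $T=\infty$). For every $t$ in this interval, $$u(t)=e^{-t(\Delta+\operatorname{id})}u_0+\int_0^te^{-(t-s)(\Delta+\operatorname{id})}h(s)\,ds,\qquad \|u(t)\|_p\le e^{-t}\|u_0\|_p+\int_0^te^{-(t-s)}\|h(s)\|_p\,ds.$$ This $u$ is also a mild solution of the problem for $\mathcal A$ with the domain $\operatorname{dom}_p(\mathcal A)$. It is the only one if $\sum_n\mu(x_n)=\infty$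 for every infinite path $(x_n)$ (a sequence of distinct nodes with $w(x_n,x_{n+1})>0$ for all $n$), or if $\sup_x\mu(x)^{-1}\sum_yw(x,y)<\infty$. -/

import Mathlib

open Set Filter Topology MeasureTheory
open scoped ENNReal

/-- A weighted graph `(X, w, κ, μ)` with node set `X`. Countability of `X` is a hypothesis of the
theorem. -/
structure WGraph (X : Type*) where
  w : X → X → ℝ
  kappa : X → ℝ
  mu : X → ℝ
  w_nonneg : ∀ x y, 0 ≤ w x y
  kappa_nonneg : ∀ x, 0 ≤ kappa x
  mu_pos : ∀ x, 0 < mu x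
  w_symm : ∀ x y, w x y = w y x
  w_loopless : ∀ x, w x x = 0
  w_summable : ∀ x, Summable (w x)

namespace WGraph

variable {X : Type*}

/-- The node measure as a measure on all subsets of `X`: the point `x` has mass `μ(x)`. -/
noncomputable def nodeMeasure (G : WGraph X) : @Measure X ⊤ :=
  letI : MeasurableSpace X := ⊤
  Measure.sum fun x => ENNReal.ofReal (G.mu x) • Measure.dirac x

/-- The Banach space `ℓ^p(X, μ)`. Every node has positive mass, so elements are determined by their
values at all nodes (see `ell_ext`). -/
noncomputable abbrev ell (G : WGraph X) (p : ℝ≥0∞) := Lp ℝ p G.nodeMeasure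

lemma ae_nodeMeasure_iff [Countable X] (G : WGraph X) (P : X → Prop) :
    (∀ᵐ x ∂G.nodeMeasure, P x) ↔ ∀ x, P x := by
  let _ : MeasurableSpace X := ⊤
  unfold nodeMeasure
  rw [Measure.ae_sum_iff]
  refine forall_congr' fun x => ?_
  have hx : ENNReal.ofReal (G.mu x) ≠ 0 := by simpa using G.mu_pos x
  rw [Measure.ae_ennreal_smul_measure_iff hx, ae_dirac_eq]
  rfl

lemma ell_ext [Countable X] (G : WGraph X) (p : ℝ≥0∞) (u v : G.ell p)
    (huv : ∀ x, u x = v x) : u = v :=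
  Lp.ext ((G.ae_nodeMeasure_iff _).2 huv)

/-- The norm of `ℓ^p(X, μ)` is the `p`-th root of the sum of `|u(x)|^p μ(x)`. -/
lemma ell_norm [Countable X] (G : WGraph X) (p : ℝ≥0∞) [hp1 : Fact (1 ≤ p)] (hp : p ≠ ∞)
    (u : G.ell p) : ‖u‖ = (∑' x, |u x| ^ p.toReal * G.mu x) ^ (1 / p.toReal) := by
  let _ : MeasurableSpace X := ⊤
  have hp0 : p ≠ 0 := (zero_lt_one.trans_le hp1.out).ne'
  have key : ∀ φ : X → ℝ≥0∞,
      ∫⁻ x, φ x ∂G.nodeMeasure = ∑' x, ENNReal.ofReal (G.mu x) * φ x := by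
    intro φ
    unfold nodeMeasure
    rw [lintegral_sum_measure]
    refine tsum_congr fun x => ?_
    rw [lintegral_smul_measure, lintegral_dirac, smul_eq_mul]
  rw [Lp.norm_def, eLpNorm_eq_lintegral_rpow_enorm_toReal hp0 hp, key, ← ENNReal.toReal_rpow,
    ENNReal.tsum_toReal_eq]
  · congr 2
    funext x
    rw [ENNReal.toReal_mul, ENNReal.toReal_ofReal (G.mu_pos x).le, ← ENNReal.toReal_rpow,
      toReal_enorm, Real.norm_eq_abs, mul_comm]
  · intro x
    exact ENNReal.mul_ne_top ENNReal.ofReal_ne_top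
      (ENNReal.rpow_ne_top_of_nonneg ENNReal.toReal_nonneg enorm_ne_top)

/-- Domain of the formal graph Laplacian. -/
def domLap (G : WGraph X) (u : X → ℝ) : Prop :=
  ∀ x, Summable fun y => G.w x y * |u y|

/-- The formal graph Laplacian (meaningful for `u` in `domLap`). -/
noncomputable def lap (G : WGraph X) (u : X → ℝ) (x : X) : ℝ :=
  (1 / G.mu x) * (∑' y, G.w x y * (u x - u y)) + (G.kappa x / G.mu x) * u x

/-- Condition `C_p`, for `1 ≤ p < ∞`. -/
def CondC (G : WGraph X) (p : ℝ≥0∞) : Prop :=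
  ∀ x, Summable fun y => G.w x y ^ p.toReal / G.mu y ^ (p.toReal - 1)

/-- Condition (IP): every infinite path has infinite measure. -/
def CondIP (G : WGraph X) : Prop :=
  ∀ γ : ℕ → X, Function.Injective γ → (∀ n, G.w (γ n) (γ (n + 1)) ≠ 0) →
    ¬ Summable fun n => G.mu (γ n)

/-- Condition (B): bounded edge degree. -/
def CondB (G : WGraph X) : Prop :=
  ∃ C : ℝ, ∀ x, (∑' y, G.w x y) / G.mu x ≤ C

/-- The Dirichlet subgraph on a finite set of nodes. -/
noncomputable def dirichlet (G : WGraph X) (S : Finset X) : WGraph S where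
  w x y := G.w x y
  kappa x := G.kappa x + ∑' z : {z : X // z ∉ S}, G.w x z
  mu x := G.mu x
  w_nonneg x y := G.w_nonneg x y
  kappa_nonneg x := add_nonneg (G.kappa_nonneg x) (tsum_nonneg fun z => G.w_nonneg x z)
  mu_pos x := G.mu_pos x
  w_symm x y := G.w_symm x y
  w_loopless x := G.w_loopless x
  w_summable _ := Summable.of_finite

/-- The operator `𝒜 = Δ - f` on `ℓ^p(X, μ)`, as a graph: `u ∈ dom_p(𝒜)` and `𝒜 u = v`. Here
`dom_p(𝒜)` is the maximal domain: all `u ∈ ℓ^p ∩ dom(Δ)` with `Δu - f(u) ∈ ℓ^p`. -/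
def opA (G : WGraph X) (f : ℝ → ℝ) (p : ℝ≥0∞) (u v : G.ell p) : Prop :=
  G.domLap u ∧ ∀ x, v x = -f (u x) + G.lap u x

open Classical in
/-- The approximating operator attached to a finite set `S` of nodes: restrict to `S`, apply
`Δ_dir - f` there, and extend by zero. -/
noncomputable def opApprox (G : WGraph X) (f : ℝ → ℝ) (S : Finset X) (u : X → ℝ) (x : X) : ℝ :=
  if hx : x ∈ S then -f (u x) + (G.dirichlet S).lap (fun y : S => u y) ⟨x, hx⟩ else 0

/-- An increasing exhaustion of the node set by finite sets. -/
def IsExhaustion (E : ℕ → Finset X) : Prop :=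
  Monotone E ∧ ∀ x, ∃ n, x ∈ E n

/-- The restriction of `𝒜` to the set `Ω_p` of those `u ∈ dom_p(𝒜)` for which there are `u_n`
supported in `E n` with `u_n → u` and `𝒜_n u_n → 𝒜 u` in `ℓ^p`; again as a graph: `u ∈ Ω_p` and
`𝒜 u = v`. -/
def opOmega (G : WGraph X) (f : ℝ → ℝ) (p : ℝ≥0∞) [Fact (1 ≤ p)] (E : ℕ → Finset X) (u v : G.ell p) : Prop :=
  G.opA f p u v ∧
    ∃ un an : ℕ → G.ell p,
      (∀ n, ∀ x ∉ E n, un n x = 0) ∧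
      (∀ n x, an n x = G.opApprox f (E n) (un n) x) ∧
      Tendsto un atTop (𝓝 u) ∧ Tendsto an atTop (𝓝 v)

end WGraph

section Evolution

variable {B : Type*} [NormedAddCommGroup B] [NormedSpace ℝ B]

/-- `(t, hd)` with `0 = t 0 < ⋯ < t N ≤ T` is an `ε`-discretization of `([0, T]; h)`. -/
structure IsDiscretization (T : ℝ) (h : ℝ → B) (ε : ℝ) (N : ℕ) (t : ℕ → ℝ) (hd : ℕ → B) :
    Prop where
  zero : t 0 = 0
  lt : ∀ k < N, t k < t (k + 1)
  le : t N ≤ T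
  mesh : ∀ k < N, t (k + 1) - t k ≤ ε
  last : T - t N ≤ ε
  err : ∑ k ∈ Finset.range N, ∫ s in t k..t (k + 1), ‖h s - hd (k + 1)‖ ≤ ε

/-- `ud` solves the implicit Euler scheme for the (single-valued) operator with graph `A`, started
at `u₀`; in particular `ud k` is in the domain of the operator for `1 ≤ k ≤ N`. -/
def IsEuler (A : B → B → Prop) (u₀ : B) (N : ℕ) (t : ℕ → ℝ) (hd ud : ℕ → B) : Prop :=
  ud 0 = u₀ ∧ ∀ k < N, ∃ v, A (ud (k + 1)) v ∧
    ud (k + 1) + (t (k + 1) - t k) • v = ud k + (t (k + 1) - t k) • hd (k + 1)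

/-- Mild solutions of `u' + A u = h`, `u(0) = u₀` on a bounded interval `[0, T]`: continuous
functions that are uniform limits of `ε`-approximate solutions, the latter being equal to `u₀` at
`0` and to `ud (k + 1)` on `(t k, t (k + 1)]`. -/
def IsMildOn (A : B → B → Prop) (h : ℝ → B) (u₀ : B) (T : ℝ) (u : ℝ → B) : Prop :=
  ContinuousOn u (Icc 0 T) ∧
    ∀ ε > 0, ∃ (N : ℕ) (t : ℕ → ℝ) (hd ud : ℕ → B),
      IsDiscretization T h ε N t hd ∧ IsEuler A u₀ N t hd ud ∧
      ‖u 0 - u₀‖ < ε ∧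
      ∀ k < N, ∀ s ∈ Ioc (t k) (t (k + 1)), ‖u s - ud (k + 1)‖ < ε

/-- The time interval `[0, T]`, read as `[0, ∞)` for `T = ∞`. -/
def timeInterval (T : ℝ≥0∞) : Set ℝ := {t | 0 ≤ t ∧ ENNReal.ofReal t ≤ T}

/-- Mild solutions for `T ≤ ∞`; for `T = ∞` the restriction to every `[0, a]` has to be mild. -/
def IsMild (A : B → B → Prop) (h : ℝ → B) (u₀ : B) (T : ℝ≥0∞) (u : ℝ → B) : Prop :=
  (T ≠ ∞ → IsMildOn A h u₀ T.toReal u) ∧ (T = ∞ → ∀ a > 0, IsMildOn A h u₀ a u)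

/-- `S t = e^{-tA}` for `t ≥ 0`: `S` is a strongly continuous semigroup of bounded operators and its
infinitesimal generator is exactly `-A`, domain included. (This determines `S t` for `t ≥ 0`.) -/
structure IsExpNeg (A : B → B → Prop) (S : ℝ → B →L[ℝ] B) : Prop where
  zero : S 0 = ContinuousLinearMap.id ℝ B
  add : ∀ s t, 0 ≤ s → 0 ≤ t → S (s + t) = (S s).comp (S t)
  cont : ∀ x, ContinuousOn (fun t => S t x) (Ici 0)
  gen : ∀ u v, A u v ↔ Tendsto (fun t : ℝ => t⁻¹ • (u - S t u)) (𝓝[>] 0) (𝓝 v)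

end Evolution

/-! The restriction of `𝒜` to `Ω_p` is linear, densely defined and m-accretive with a gain: `(1 +
l)‖u‖ ≤ ‖u + l𝒜u‖`, and `1 + l𝒜` is onto for every `l > 0` (`isMAccretive_opOmega`). Apart from
uniqueness on the maximal domain, everything follows from this.

Accretivity passes to `Ω_p` in the limit from the finite Dirichlet graphs, where it comes from
convexity of `r ↦ r ^ p` and symmetry of `w` (`opApprox_accretive`). For the range, take `f ≥ 0`:
the Dirichlet resolvents of `f` increase along the exhaustion by the minimum principle and are
bounded in `ℓ^p` by accretivity, and their limit lies in `Ω_p` (`opOmega_range_of_nonneg`). A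
general `f` is split into positive and negative parts. Density holds because indicators of points
lie in `Ω_p`; only this uses `CondC`.

The semigroup is the Hille–Yosida limit of the exponentials of the Yosida approximations, and the
gain in accretivity becomes the factor `e^{-t}`. For mild solutions the main fact is that every
sufficiently fine implicit Euler scheme is uniformly close to the Duhamel function
(`exists_euler_close`). Applied to schemes on uniform grids it gives existence; applied to the
schemes that approximate a given mild solution it gives uniqueness. Since a Duhamel function need
not take values in the domain, schemes are compared with `J l ∘ z`, where `z` is the Duhamel
function of a continuous forcing; this regularization satisfies an integrated equation with
continuous terms.

Enlarging the operator keeps mild solutions mild. Under (IP) or (B), `1 + 𝒜` is injective on the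
maximal domain; as it is already onto from `Ω_p`, the two domains coincide (`opOmega_of_opA`). -/

section Semigroup

variable {B : Type*} [NormedAddCommGroup B] [NormedSpace ℝ B]

/-- `A - id` is a densely defined, m-accretive linear operator, given as a graph. -/
structure IsMAccretive (A : B → B → Prop) : Prop where
  add : ∀ {u v u' v'}, A u v → A u' v' → A (u + u') (v + v')
  smul : ∀ (c : ℝ) {u v}, A u v → A (c • u) (c • v)
  accretive : ∀ {u v}, A u v → ∀ {l : ℝ}, 0 < l → (1 + l) * ‖u‖ ≤ ‖u + l • v‖
  range : ∀ {l : ℝ}, 0 < l → ∀ f, ∃ u v, A u v ∧ u + l • v = f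
  dense : Dense {u | ∃ v, A u v}

/-! ### Resolvents and Yosida approximations -/

namespace IsMAccretive

variable {A : B → B → Prop}

lemma sub (hA : IsMAccretive A) {u v u' v' : B} (h : A u v) (h' : A u' v') :
    A (u - u') (v - v') := by
  simpa [sub_eq_add_neg] using hA.add h (hA.smul (-1) h')

lemma eq_of_add_eq (hA : IsMAccretive A) {l : ℝ} (hl : 0 < l) {u v u' v' : B} (h : A u v)
    (h' : A u' v') (e : u + l • v = u' + l • v') : u = u' := by
  have h1 := hA.accretive (hA.sub h h') hl
  have h2 : u - u' + l • (v - v') = 0 := by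
    rw [smul_sub, sub_add_sub_comm, e, sub_self]
  rw [h2, norm_zero] at h1
  have h3 : ‖u - u'‖ ≤ 0 := by
    by_contra! h4
    nlinarith
  exact sub_eq_zero.1 (norm_le_zero_iff.1 h3)

lemma exists_resolvent (hA : IsMAccretive A) {l : ℝ} (hl : 0 < l) :
    ∃ J : B →L[ℝ] B, (∀ f, A (J f) (l⁻¹ • (f - J f))) ∧ ∀ f, ‖J f‖ ≤ (1 + l)⁻¹ * ‖f‖ := by
  choose j v hj hv using fun f => hA.range hl f
  have hv' : ∀ f, v f = l⁻¹ • (f - j f) := fun f => by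
    rw [eq_inv_smul_iff₀ hl.ne', eq_sub_iff_add_eq', hv f]
  have hb : ∀ f, ‖j f‖ ≤ (1 + l)⁻¹ * ‖f‖ := fun f => by
    have := hA.accretive (hj f) hl
    rw [hv] at this
    rw [inv_mul_eq_div, le_div_iff₀ (by positivity), mul_comm]
    exact this
  let J : B →ₗ[ℝ] B :=
    { toFun := j
      map_add' := fun f g => hA.eq_of_add_eq hl (hj _) (hA.add (hj f) (hj g)) (by
        rw [hv, smul_add, add_add_add_comm, hv, hv])
      map_smul' := fun c f => hA.eq_of_add_eq hl (hj _) (hA.smul c (hj f)) (by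
        rw [hv, RingHom.id_apply, smul_comm, ← smul_add, hv]) }
  refine ⟨J.mkContinuous _ hb, fun f => ?_, hb⟩
  have := hj f
  rw [hv'] at this
  exact this

open Classical in
/-- The resolvent `(1 + l A)⁻¹` for `l > 0`. -/
noncomputable def J (hA : IsMAccretive A) (l : ℝ) : B →L[ℝ] B :=
  if hl : 0 < l then (hA.exists_resolvent hl).choose else 0

/-- The negative of the Yosida approximation. -/
noncomputable def Y (hA : IsMAccretive A) (l : ℝ) : B →L[ℝ] B :=
  l⁻¹ • (hA.J l - 1)

variable (hA : IsMAccretive A)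

include hA

lemma J_graph {l : ℝ} (hl : 0 < l) (f : B) : A (hA.J l f) (-(hA.Y l f)) := by
  have := (hA.exists_resolvent hl).choose_spec.1 f
  have e : hA.J l = (hA.exists_resolvent hl).choose := dif_pos hl
  rw [← e] at this
  convert this using 1
  simp [Y, ← smul_neg]

lemma norm_J_le {l : ℝ} (hl : 0 < l) (f : B) : ‖hA.J l f‖ ≤ (1 + l)⁻¹ * ‖f‖ := by
  have := (hA.exists_resolvent hl).choose_spec.2 f
  have e : hA.J l = (hA.exists_resolvent hl).choose := dif_pos hl
  rwa [← e] at this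

lemma norm_J_le' {l : ℝ} (hl : 0 < l) (f : B) : ‖hA.J l f‖ ≤ ‖f‖ :=
  (hA.norm_J_le hl f).trans (mul_le_of_le_one_left (norm_nonneg _)
    (inv_le_one_of_one_le₀ (by linarith)))

lemma J_sub_smul_Y {l : ℝ} (hl : 0 < l) (f : B) : hA.J l f - l • hA.Y l f = f := by
  simp [Y, smul_smul, hl.ne']

lemma J_eq {l : ℝ} (hl : 0 < l) {u v f : B} (h : A u v) (e : u + l • v = f) : hA.J l f = u := by
  refine hA.eq_of_add_eq hl (hA.J_graph hl f) h ?_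
  rw [e, smul_neg, ← sub_eq_add_neg, hA.J_sub_smul_Y hl]

lemma Y_eq {l : ℝ} (hl : 0 < l) {u v : B} (h : A u v) : hA.Y l u = -hA.J l v := by
  have h1 := hA.J_eq hl h rfl
  simp only [Y, map_add, map_smul] at h1 ⊢
  rw [smul_apply, sub_apply, inv_smul_eq_iff₀ hl.ne']
  rw [smul_neg, ← sub_eq_zero]
  nth_rewrite 2 [← h1]
  simp

lemma graph_J {l : ℝ} (hl : 0 < l) {u v : B} (h : A u v) : A (hA.J l u) (hA.J l v) := by
  have := hA.J_graph hl u
  rwa [hA.Y_eq hl h, neg_neg] at this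

lemma J_comm {l m : ℝ} (hl : 0 < l) (hm : 0 < m) : Commute (hA.J l) (hA.J m) := by
  ext f
  change hA.J l (hA.J m f) = hA.J m (hA.J l f)
  refine hA.J_eq hl (hA.graph_J hm (hA.J_graph hl f)) ?_
  rw [← map_smul, ← map_add, smul_neg, ← sub_eq_add_neg, hA.J_sub_smul_Y hl]

lemma Y_comm_J {l m : ℝ} (hl : 0 < l) (hm : 0 < m) : Commute (hA.Y l) (hA.J m) :=
  ((hA.J_comm hl hm).sub_left (Commute.one_left _)).smul_left _

lemma Y_comm {l m : ℝ} (hl : 0 < l) (hm : 0 < m) : Commute (hA.Y l) (hA.Y m) :=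
  ((hA.Y_comm_J hl hm).sub_right (Commute.one_right _)).smul_right _

lemma norm_J_sub_le {l : ℝ} (hl : 0 < l) {u v : B} (h : A u v) : ‖hA.J l u - u‖ ≤ l * ‖v‖ := by
  have h1 := hA.J_sub_smul_Y hl u
  have h2 : hA.J l u - u = l • hA.Y l u := by
    nth_rewrite 2 [← h1]
    simp
  rw [h2, hA.Y_eq hl h, norm_smul, norm_neg, Real.norm_of_nonneg hl.le]
  exact mul_le_mul_of_nonneg_left (hA.norm_J_le' hl v) hl.le

lemma exists_graph_near (x : B) {ε : ℝ} (hε : 0 < ε) : ∃ u v, A u v ∧ ‖x - u‖ < ε := by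
  obtain ⟨u, ⟨v, h⟩, hu⟩ := hA.dense.exists_dist_lt x hε
  exact ⟨u, v, h, by rwa [← dist_eq_norm]⟩

/-- On the domain the error is at most `l * ‖v‖`; density and the contraction bound carry the
convergence to all of `B`. -/
lemma tendsto_J (x : B) : Tendsto (fun l => hA.J l x) (𝓝[>] 0) (𝓝 x) := by
  rw [Metric.tendsto_nhds]
  intro ε hε
  obtain ⟨u, v, h, hu⟩ := hA.exists_graph_near x (ε := ε / 4) (by positivity)
  have h1 : ∀ᶠ l : ℝ in 𝓝[>] 0, l * ‖v‖ < ε / 4 := by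
    have : Tendsto (fun l : ℝ => l * ‖v‖) (𝓝[>] 0) (𝓝 (0 * ‖v‖)) :=
      ((continuous_id.mul continuous_const).tendsto 0).mono_left nhdsWithin_le_nhds
    exact this.eventually_lt_const (by simpa using by positivity)
  filter_upwards [h1, self_mem_nhdsWithin] with l hl1 hl
  have hl : 0 < l := hl
  have h2 := hA.norm_J_sub_le hl h
  have h3 := hA.norm_J_le' hl (x - u)
  rw [dist_eq_norm]
  have : hA.J l x - x = hA.J l (x - u) + (hA.J l u - u) - (x - u) := by
    rw [map_sub]; abel
  rw [this]
  calc _ ≤ ‖hA.J l (x - u)‖ + ‖hA.J l u - u‖ + ‖x - u‖ :=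
        (norm_sub_le _ _).trans (by gcongr; exact norm_add_le _ _)
    _ < ε := by linarith

lemma tendsto_Y {u v : B} (h : A u v) : Tendsto (fun l => hA.Y l u) (𝓝[>] 0) (𝓝 (-v)) := by
  refine (hA.tendsto_J v).neg.congr' ?_
  filter_upwards [self_mem_nhdsWithin] with l hl
  rw [hA.Y_eq hl h]

omit hA in
lemma norm_exp_le_exp_norm {𝔸 : Type*} [NormedRing 𝔸] [NormedAlgebra ℝ 𝔸] [CompleteSpace 𝔸]
    [NormOneClass 𝔸] (a : 𝔸) : ‖NormedSpace.exp a‖ ≤ Real.exp ‖a‖ := by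
  rw [NormedSpace.exp_eq_tsum ℝ, Real.exp_eq_exp_ℝ, NormedSpace.exp_eq_tsum ℝ]
  refine tsum_of_norm_bounded (NormedSpace.expSeries_summable' (𝕂 := ℝ) ‖a‖).hasSum fun n => ?_
  rw [norm_smul, smul_eq_mul]
  gcongr
  · simp
  · exact norm_pow_le a n

/-- The approximating semigroups. -/
noncomputable def expY (l t : ℝ) : B →L[ℝ] B := NormedSpace.exp (t • hA.Y l)

/-! ### The Yosida semigroups, their limit and its generator -/

variable [CompleteSpace B]

lemma norm_expY_le {l t : ℝ} (hl : 0 < l) (ht : 0 ≤ t) (x : B) :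
    ‖hA.expY l t x‖ ≤ Real.exp (-t / (1 + l)) * ‖x‖ := by
  -- The identity has operator norm one only if `B` is nontrivial.
  rcases subsingleton_or_nontrivial B with hB | hB
  · simp [Subsingleton.elim _ (0 : B)]
  refine (ContinuousLinearMap.le_opNorm _ _).trans ?_
  gcongr
  -- The scalar part contributes exactly `e^{-t/l}` and the resolvent part at most `e^{t/(l(1+l))}`;
  -- the exponents add up to `-t/(1+l)`.
  have e : t • hA.Y l = (t / l) • hA.J l + algebraMap ℝ (B →L[ℝ] B) (-(t / l)) := by
    simp only [Y, smul_smul, smul_sub, Algebra.algebraMap_eq_smul_one, neg_smul, div_eq_mul_inv]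
    abel
  let _ : NormedAlgebra ℚ (B →L[ℝ] B) := NormedAlgebra.restrictScalars ℚ ℝ _
  rw [expY, e, NormedSpace.exp_add_of_commute (Algebra.commutes _ _).symm,
    ← NormedSpace.algebraMap_exp_comm, ← Real.exp_eq_exp_ℝ]
  refine (norm_mul_le _ _).trans ?_
  rw [norm_algebraMap', Real.norm_of_nonneg (Real.exp_pos _).le]
  have h1 : ‖(t / l) • hA.J l‖ ≤ t / l * (1 + l)⁻¹ := by
    rw [norm_smul, Real.norm_of_nonneg (by positivity)]
    gcongr
    exact ContinuousLinearMap.opNorm_le_bound _ (by positivity) (hA.norm_J_le hl)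
  calc _ ≤ Real.exp (t / l * (1 + l)⁻¹) * Real.exp (-(t / l)) := by
        gcongr
        exact (norm_exp_le_exp_norm _).trans (Real.exp_le_exp.2 h1)
    _ = _ := by
        rw [← Real.exp_add]
        congr 1
        field_simp
        ring

lemma norm_expY_le' {l t : ℝ} (hl : 0 < l) (ht : 0 ≤ t) (x : B) : ‖hA.expY l t x‖ ≤ ‖x‖ :=
  (hA.norm_expY_le hl ht x).trans (mul_le_of_le_one_left (norm_nonneg _)
    (Real.exp_le_one_iff.2 (div_nonpos_of_nonpos_of_nonneg (by linarith) (by linarith))))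

lemma expY_add (l s t : ℝ) : hA.expY l (s + t) = hA.expY l s * hA.expY l t := by
  let _ : NormedAlgebra ℚ (B →L[ℝ] B) := NormedAlgebra.restrictScalars ℚ ℝ _
  rw [expY, add_smul, NormedSpace.exp_add_of_commute]
  · rfl
  · exact ((Commute.refl _).smul_left _).smul_right _

omit [CompleteSpace B] in
lemma expY_zero (l : ℝ) : hA.expY l 0 = 1 := by
  simp [expY, NormedSpace.exp_zero]

lemma hasDerivAt_expY (l t : ℝ) : HasDerivAt (hA.expY l) (hA.expY l t * hA.Y l) t :=
  hasDerivAt_exp_smul_const (hA.Y l) t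

omit [CompleteSpace B] in
lemma expY_comm_Y {l m : ℝ} (hl : 0 < l) (hm : 0 < m) (t : ℝ) :
    Commute (hA.expY l t) (hA.Y m) :=
  ((hA.Y_comm hl hm).smul_left t).exp_left

omit [CompleteSpace B] in
lemma expY_comm_J {l m : ℝ} (hl : 0 < l) (hm : 0 < m) (t : ℝ) :
    Commute (hA.expY l t) (hA.J m) :=
  ((hA.Y_comm_J hl hm).smul_left t).exp_left

lemma norm_expY_sub_expY_le {l m t : ℝ} (hl : 0 < l) (hm : 0 < m) (ht : 0 ≤ t) (x : B) :
    ‖hA.expY l t x - hA.expY m t x‖ ≤ t * ‖hA.Y l x - hA.Y m x‖ := by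
  -- This path joins `expY m t` at `s = 0` to `expY l t` at `s = t`. As everything commutes, its
  -- derivative is two contractions applied to `Y l - Y m`.
  let f : ℝ → B →L[ℝ] B := fun s => hA.expY l s * hA.expY m (t - s)
  have hf : ∀ s, HasDerivAt f (hA.expY l s * hA.expY m (t - s) * (hA.Y l - hA.Y m)) s := by
    intro s
    have h1 : HasDerivAt (fun s => hA.expY m (t - s)) (-(hA.expY m (t - s) * hA.Y m)) s := by
      refine ((hA.hasDerivAt_expY m (t - s)).scomp s
        ((hasDerivAt_id s).const_sub t)).congr_deriv ?_
      simp
    refine ((hA.hasDerivAt_expY l s).mul h1).congr_deriv ?_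
    have h2 := (hA.expY_comm_Y hm hl (t - s)).eq
    rw [mul_sub, mul_assoc _ _ (hA.Y l), h2, ← mul_assoc, mul_assoc _ (hA.expY m (t - s)),
      mul_neg, ← sub_eq_add_neg]
  have hfx : ∀ s, HasDerivAt (fun s => f s x)
      (hA.expY l s (hA.expY m (t - s) (hA.Y l x - hA.Y m x))) s := by
    intro s
    refine ((hf s).clm_apply (hasDerivAt_const s x)).congr_deriv ?_
    simp
  have key := norm_image_sub_le_of_norm_deriv_le_segment' (a := 0) (b := t)
    (C := ‖hA.Y l x - hA.Y m x‖) (fun s _ => (hfx s).hasDerivWithinAt) (fun s hs =>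
      (hA.norm_expY_le' hl hs.1 _).trans (hA.norm_expY_le' hm (sub_nonneg.2 hs.2.le) _)) t
      ⟨ht, le_rfl⟩
  simpa [f, expY_zero, mul_comm] using key

lemma norm_expY_sub_le {l t : ℝ} (hl : 0 < l) (ht : 0 ≤ t) (x : B) :
    ‖hA.expY l t x - x‖ ≤ t * ‖hA.Y l x‖ := by
  have hfx : ∀ s, HasDerivAt (fun s => hA.expY l s x) (hA.expY l s (hA.Y l x)) s := by
    intro s
    refine ((hA.hasDerivAt_expY l s).clm_apply (hasDerivAt_const s x)).congr_deriv ?_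
    simp
  have key := norm_image_sub_le_of_norm_deriv_le_segment' (a := 0) (b := t)
    (C := ‖hA.Y l x‖) (fun s _ => (hfx s).hasDerivWithinAt) (fun s hs =>
      (hA.norm_expY_le' hl hs.1 _)) t ⟨ht, le_rfl⟩
  simpa [expY_zero, mul_comm] using key

/-- A first-order expansion at `t = 0` whose error survives the limit `l → 0`. That limit turns `Y l
x` into `-v`, which need not lie in the domain; the free vector `y` will be a domain element close
to it. -/
lemma norm_expY_sub_sub_le {l t : ℝ} (hl : 0 < l) (ht : 0 ≤ t) (x y : B) :
    ‖hA.expY l t x - x - t • hA.Y l x‖ ≤ t * (2 * ‖hA.Y l x - y‖ + t * ‖hA.Y l y‖) := by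
  have hfx : ∀ s, HasDerivAt (fun s => hA.expY l s x - s • hA.Y l x)
      (hA.expY l s (hA.Y l x) - hA.Y l x) s := by
    intro s
    refine (((hA.hasDerivAt_expY l s).clm_apply (hasDerivAt_const s x)).sub
      ((hasDerivAt_id s).smul_const (hA.Y l x))).congr_deriv ?_
    simp
  have key := norm_image_sub_le_of_norm_deriv_le_segment' (a := 0) (b := t)
    (C := 2 * ‖hA.Y l x - y‖ + t * ‖hA.Y l y‖) (fun s _ => (hfx s).hasDerivWithinAt)
    (fun s hs => ?_) t ⟨ht, le_rfl⟩
  · have e : hA.expY l t x - x - t • hA.Y l x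
        = hA.expY l t x - t • hA.Y l x - (hA.expY l 0 x - (0 : ℝ) • hA.Y l x) := by
      simp [expY_zero]; abel
    rw [e, mul_comm]
    simpa using key
  · have e : hA.expY l s (hA.Y l x) - hA.Y l x
        = hA.expY l s (hA.Y l x - y) + (hA.expY l s y - y) - (hA.Y l x - y) := by
      rw [map_sub]; abel
    rw [e]
    have h1 := hA.norm_expY_le' hl hs.1 (hA.Y l x - y)
    have h2 := hA.norm_expY_sub_le hl hs.1 y
    have h3 : s * ‖hA.Y l y‖ ≤ t * ‖hA.Y l y‖ := by gcongr; exact hs.2.le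
    calc _ ≤ ‖hA.expY l s (hA.Y l x - y)‖ + ‖hA.expY l s y - y‖ + ‖hA.Y l x - y‖ :=
          (norm_sub_le _ _).trans (by gcongr; exact norm_add_le _ _)
      _ ≤ _ := by linarith


/-- On the domain the net is Cauchy because `Y l u` converges; a domain element near `x` suffices
since all the maps are contractions. -/
lemma exists_tendsto_expY {t : ℝ} (ht : 0 ≤ t) (x : B) :
    ∃ y, Tendsto (fun l => hA.expY l t x) (𝓝[>] 0) (𝓝 y) := by
  refine CompleteSpace.complete (Metric.cauchy_iff.2 ⟨inferInstance, fun ε hε => ?_⟩)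
  obtain ⟨u, v, h, hu⟩ := hA.exists_graph_near x (ε := ε / 4) (by positivity)
  obtain ⟨δ, hδ, hδt⟩ : ∃ δ > 0, t * (2 * δ) < ε / 4 := by
    refine ⟨ε / (16 * (t + 1)), by positivity, ?_⟩
    have : t * (2 * (ε / (16 * (t + 1)))) = (t / (t + 1)) * (ε / 8) := by field_simp; ring
    rw [this]
    have : t / (t + 1) ≤ 1 := div_le_one_of_le₀ (by linarith) (by linarith)
    nlinarith
  refine ⟨(fun l => hA.expY l t x) '' {l | 0 < l ∧ dist (hA.Y l u) (-v) < δ},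
    image_mem_map (inter_mem self_mem_nhdsWithin ((hA.tendsto_Y h).eventually
      (Metric.ball_mem_nhds _ hδ))), ?_⟩
  rintro _ ⟨l, ⟨hl, hlu⟩, rfl⟩ _ ⟨m, ⟨hm, hmu⟩, rfl⟩
  have h1 := hA.norm_expY_sub_expY_le hl hm ht u
  have h2 : ‖hA.Y l u - hA.Y m u‖ ≤ 2 * δ := by
    rw [← dist_eq_norm]
    have := dist_triangle_right (hA.Y l u) (hA.Y m u) (-v)
    linarith
  have h3 := hA.norm_expY_le' hl ht (x - u)
  have h4 := hA.norm_expY_le' hm ht (x - u)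
  have e : hA.expY l t x - hA.expY m t x
      = hA.expY l t (x - u) + (hA.expY l t u - hA.expY m t u) - hA.expY m t (x - u) := by
    simp only [map_sub]; abel
  rw [dist_eq_norm, e]
  calc _ ≤ ‖hA.expY l t (x - u)‖ + ‖hA.expY l t u - hA.expY m t u‖ + ‖hA.expY m t (x - u)‖ :=
        (norm_sub_le _ _).trans (by gcongr; exact norm_add_le _ _)
    _ ≤ ‖x - u‖ + t * (2 * δ) + ‖x - u‖ := by
        gcongr
        exact h1.trans (by gcongr)
    _ < ε := by linarith

lemma exists_semigroup {t : ℝ} (ht : 0 ≤ t) :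
    ∃ S : B →L[ℝ] B, ∀ x, Tendsto (fun l => hA.expY l t x) (𝓝[>] 0) (𝓝 (S x)) := by
  choose s hs using hA.exists_tendsto_expY ht
  let S : B →ₗ[ℝ] B :=
    { toFun := s
      map_add' := fun x y => tendsto_nhds_unique (hs _) (by
        simpa only [map_add] using (hs x).add (hs y))
      map_smul' := fun c x => tendsto_nhds_unique (hs _) (by
        simpa only [map_smul, RingHom.id_apply] using (hs x).const_smul c) }
  refine ⟨S.mkContinuous 1 fun x => ?_, hs⟩
  rw [one_mul]
  refine le_of_tendsto (hs x).norm ?_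
  filter_upwards [self_mem_nhdsWithin] with l hl
  exact hA.norm_expY_le' hl ht x

/-- The semigroup generated by `-A`, extended by the identity to negative times. -/
noncomputable def S (t : ℝ) : B →L[ℝ] B := (hA.exists_semigroup (le_max_right t 0)).choose

lemma S_eq_max (t : ℝ) : hA.S t = hA.S (max t 0) := by
  unfold S
  congr! 4
  simp

lemma tendsto_expY {t : ℝ} (ht : 0 ≤ t) (x : B) :
    Tendsto (fun l => hA.expY l t x) (𝓝[>] 0) (𝓝 (hA.S t x)) := by
  have h : Tendsto (fun l => hA.expY l (max t 0) x) (𝓝[>] 0) (𝓝 (hA.S t x)) :=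
    (hA.exists_semigroup (le_max_right t 0)).choose_spec x
  rwa [max_eq_left ht] at h

lemma norm_S_le {t : ℝ} (ht : 0 ≤ t) (x : B) : ‖hA.S t x‖ ≤ Real.exp (-t) * ‖x‖ := by
  have h1 : Tendsto (fun l : ℝ => Real.exp (-t / (1 + l)) * ‖x‖) (𝓝[>] 0)
      (𝓝 (Real.exp (-t / (1 + 0)) * ‖x‖)) := by
    have : ContinuousAt (fun l : ℝ => Real.exp (-t / (1 + l)) * ‖x‖) 0 := by
      fun_prop (disch := norm_num)
    exact this.tendsto.mono_left nhdsWithin_le_nhds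
  rw [add_zero, div_one] at h1
  refine le_of_tendsto_of_tendsto (hA.tendsto_expY ht x).norm h1 ?_
  filter_upwards [self_mem_nhdsWithin] with l hl
  exact hA.norm_expY_le hl ht x

lemma norm_S_le' (t : ℝ) (x : B) : ‖hA.S t x‖ ≤ ‖x‖ := by
  rw [S_eq_max]
  exact (hA.norm_S_le (le_max_right t 0) x).trans (mul_le_of_le_one_left (norm_nonneg _)
    (Real.exp_le_one_iff.2 (by simp)))

lemma S_zero : hA.S 0 = 1 := by
  ext x
  refine tendsto_nhds_unique (hA.tendsto_expY le_rfl x) ?_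
  simp [expY_zero]

lemma S_add {s t : ℝ} (hs : 0 ≤ s) (ht : 0 ≤ t) (x : B) :
    hA.S (s + t) x = hA.S s (hA.S t x) := by
  refine tendsto_nhds_unique (hA.tendsto_expY (add_nonneg hs ht) x) ?_
  -- Both factors depend on `l`; the contraction bound on the outer one lets the inner one be
  -- replaced by its limit.
  have h1 : Tendsto (fun l => hA.expY l s (hA.expY l t x - hA.S t x)) (𝓝[>] 0) (𝓝 0) := by
    refine squeeze_zero_norm' ?_ (tendsto_iff_norm_sub_tendsto_zero.1 (hA.tendsto_expY ht x))
    filter_upwards [self_mem_nhdsWithin] with l hl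
    exact hA.norm_expY_le' hl hs _
  have h2 := h1.add (hA.tendsto_expY hs (hA.S t x))
  rw [zero_add] at h2
  refine h2.congr fun l => ?_
  rw [map_sub, sub_add_cancel, expY_add]
  rfl

lemma S_comm_J {l : ℝ} (hl : 0 < l) (t : ℝ) (x : B) :
    hA.S t (hA.J l x) = hA.J l (hA.S t x) := by
  rw [S_eq_max]
  refine tendsto_nhds_unique (hA.tendsto_expY (le_max_right t 0) _) ?_
  refine (((hA.J l).continuous.tendsto _).comp (hA.tendsto_expY (le_max_right t 0) x)).congr' ?_
  filter_upwards [self_mem_nhdsWithin] with m hm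
  exact (DFunLike.congr_fun (hA.expY_comm_J hm hl _).eq x).symm

lemma norm_S_sub_le {u v : B} (h : A u v) {t : ℝ} (ht : 0 ≤ t) :
    ‖hA.S t u - u‖ ≤ t * ‖v‖ := by
  rw [← norm_neg v]
  refine le_of_tendsto_of_tendsto ((hA.tendsto_expY ht u).sub_const u).norm
    ((hA.tendsto_Y h).norm.const_mul t) ?_
  filter_upwards [self_mem_nhdsWithin] with l hl
  exact hA.norm_expY_sub_le hl ht u

lemma norm_S_sub_add_le {u v u' v' : B} (h : A u v) (h' : A u' v') {t : ℝ} (ht : 0 ≤ t) :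
    ‖hA.S t u - u + t • v‖ ≤ t * (2 * ‖v - u'‖ + t * ‖v'‖) := by
  have key := le_of_tendsto_of_tendsto
    (((hA.tendsto_expY ht u).sub_const u).sub ((hA.tendsto_Y h).const_smul t)).norm
    (((((hA.tendsto_Y h).sub_const (-u')).norm.const_mul 2).add
      ((((hA.tendsto_Y (hA.smul (-1) h')).norm.const_mul t)))).const_mul t) (by
    filter_upwards [self_mem_nhdsWithin] with l hl
    simpa using hA.norm_expY_sub_sub_le hl ht u (-u'))
  have e : -v - -u' = -(v - u') := by abel
  simpa only [smul_neg, sub_neg_eq_add, e, norm_neg, neg_smul, one_smul] using key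

lemma tendsto_S_zero (x : B) : Tendsto (fun t => hA.S t x) (𝓝 0) (𝓝 x) := by
  rw [Metric.tendsto_nhds]
  intro ε hε
  obtain ⟨u, v, h, hu⟩ := hA.exists_graph_near x (ε := ε / 4) (by positivity)
  have h1 : ∀ᶠ t : ℝ in 𝓝 0, max t 0 * ‖v‖ < ε / 4 := by
    have : Tendsto (fun t : ℝ => max t 0 * ‖v‖) (𝓝 0) (𝓝 (max 0 0 * ‖v‖)) :=
      Continuous.tendsto (by fun_prop) 0
    exact this.eventually_lt_const (by simpa using by positivity)
  filter_upwards [h1] with t ht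
  have h2 := hA.norm_S_sub_le h (le_max_right t 0)
  have h3 := hA.norm_S_le' t (x - u)
  rw [← S_eq_max] at h2
  rw [dist_eq_norm]
  have : hA.S t x - x = hA.S t (x - u) + (hA.S t u - u) - (x - u) := by
    rw [map_sub]; abel
  rw [this]
  calc _ ≤ ‖hA.S t (x - u)‖ + ‖hA.S t u - u‖ + ‖x - u‖ :=
        (norm_sub_le _ _).trans (by gcongr; exact norm_add_le _ _)
    _ < ε := by linarith

/-- Factoring out the operator at the smaller time, a contraction, reduces continuity everywhere to
continuity at zero. The maxima account for negative times. -/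
lemma norm_S_sub_S_le (s t : ℝ) (x : B) :
    ‖hA.S t x - hA.S s x‖ ≤ ‖hA.S |max t 0 - max s 0| x - x‖ := by
  wlog hst : max s 0 ≤ max t 0 generalizing s t
  · rw [norm_sub_rev, abs_sub_comm]
    exact this t s (le_of_not_ge hst)
  rw [abs_of_nonneg (sub_nonneg.2 hst), hA.S_eq_max t, hA.S_eq_max s]
  have e : max t 0 = max s 0 + (max t 0 - max s 0) := by ring
  nth_rewrite 1 [e]
  rw [hA.S_add (le_max_right _ _) (sub_nonneg.2 hst), ← map_sub]
  exact hA.norm_S_le' _ _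

lemma continuous_S_apply (x : B) : Continuous fun t => hA.S t x := by
  rw [continuous_iff_continuousAt]
  intro s
  rw [ContinuousAt, tendsto_iff_norm_sub_tendsto_zero]
  refine squeeze_zero (fun _ => norm_nonneg _) (fun t => hA.norm_S_sub_S_le s t x) ?_
  have h1 : Tendsto (fun t : ℝ => |max t 0 - max s 0|) (𝓝 s) (𝓝 0) := by
    have : Continuous (fun t : ℝ => |max t 0 - max s 0|) := by fun_prop
    simpa using this.tendsto s
  exact tendsto_iff_norm_sub_tendsto_zero.1 ((hA.tendsto_S_zero x).comp h1)

lemma continuous_S : Continuous fun q : ℝ × B => hA.S q.1 q.2 := by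
  rw [continuous_iff_continuousAt]
  rintro ⟨s, x⟩
  have h1 : Tendsto (fun q : ℝ × B => hA.S q.1 (q.2 - x)) (𝓝 (s, x)) (𝓝 0) := by
    refine squeeze_zero_norm (fun q => hA.norm_S_le' _ _) ?_
    have : Continuous fun q : ℝ × B => ‖q.2 - x‖ := by fun_prop
    simpa using this.tendsto (s, x)
  have h2 := h1.add (((hA.continuous_S_apply x).comp continuous_fst).tendsto (s, x))
  rw [zero_add] at h2
  refine h2.congr fun q => ?_
  simp

lemma tendsto_generator {u v : B} (h : A u v) :
    Tendsto (fun t : ℝ => t⁻¹ • (u - hA.S t u)) (𝓝[>] 0) (𝓝 v) := by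
  rw [Metric.tendsto_nhds]
  intro ε hε
  obtain ⟨u', v', h', hu⟩ := hA.exists_graph_near v (ε := ε / 4) (by positivity)
  have h1 : ∀ᶠ t : ℝ in 𝓝[>] 0, t * ‖v'‖ < ε / 4 := by
    have : Tendsto (fun t : ℝ => t * ‖v'‖) (𝓝[>] 0) (𝓝 (0 * ‖v'‖)) :=
      ((continuous_id.mul continuous_const).tendsto 0).mono_left nhdsWithin_le_nhds
    exact this.eventually_lt_const (by simpa using by positivity)
  filter_upwards [h1, self_mem_nhdsWithin] with t ht ht0
  have ht0 : 0 < t := ht0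
  have h2 := hA.norm_S_sub_add_le h h' ht0.le
  rw [dist_eq_norm]
  have e : t⁻¹ • (u - hA.S t u) - v = -(t⁻¹ • (hA.S t u - u + t • v)) := by
    rw [smul_add, inv_smul_smul₀ ht0.ne', ← neg_sub u, smul_neg]; abel
  rw [e, norm_neg, norm_smul, norm_inv, Real.norm_of_nonneg ht0.le, inv_mul_lt_iff₀ ht0]
  refine h2.trans_lt ?_
  gcongr
  linarith

/-- The generator is no larger than `-A`. Choose `u'` in the domain with `u' + v' = u + v`. The
quotients of `w = u - u'` then converge to `-w`, whereas for a contraction `‖t⁻¹ • ((1 + t) • w - S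
t w)‖ ≥ ‖w‖`; so `w = 0`. -/
lemma graph_of_tendsto {u v : B}
    (h : Tendsto (fun t : ℝ => t⁻¹ • (u - hA.S t u)) (𝓝[>] 0) (𝓝 v)) : A u v := by
  obtain ⟨u', v', h', e⟩ := hA.range one_pos (u + v)
  rw [one_smul] at e
  have hw := h.sub (hA.tendsto_generator h')
  have e' : v - v' = -(u - u') := by
    rw [neg_sub, sub_eq_sub_iff_add_eq_add, add_comm v, ← e]
  have key : ‖u - u'‖ ≤ 0 := by
    have h1 : ∀ t : ℝ, 0 < t → ‖u - u'‖ ≤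
        ‖t⁻¹ • (u - hA.S t u) - t⁻¹ • (u' - hA.S t u') - (v - v')‖ := by
      intro t ht
      have h2 := hA.norm_S_le' t (u - u')
      have h3 : t⁻¹ • (u - hA.S t u) - t⁻¹ • (u' - hA.S t u') - (v - v')
          = t⁻¹ • ((1 + t) • (u - u') - hA.S t (u - u')) := by
        rw [e', add_smul, one_smul, add_sub_right_comm, smul_add, inv_smul_smul₀ ht.ne', ← smul_sub,
          sub_neg_eq_add, map_sub, sub_sub_sub_comm]
      rw [h3, norm_smul, norm_inv, Real.norm_of_nonneg ht.le, ← div_eq_inv_mul, le_div_iff₀ ht]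
      have h4 := norm_sub_norm_le ((1 + t) • (u - u')) (hA.S t (u - u'))
      rw [norm_smul, Real.norm_of_nonneg (by positivity)] at h4
      linarith
    refine ge_of_tendsto (tendsto_iff_norm_sub_tendsto_zero.1 hw) ?_
    filter_upwards [self_mem_nhdsWithin] with t ht using h1 t ht
  have e2 := sub_eq_zero.1 (norm_le_zero_iff.1 key)
  subst e2
  rw [sub_self, neg_zero, sub_eq_zero] at e'
  rwa [e']

lemma isExpNeg : IsExpNeg A hA.S where
  zero := hA.S_zero
  add s t hs ht := by
    ext x
    exact hA.S_add hs ht x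
  cont x := (hA.continuous_S_apply x).continuousOn
  gen u v := ⟨hA.tendsto_generator, hA.graph_of_tendsto⟩

end IsMAccretive
end Semigroup

/-! ### The Duhamel formula and its regularization by resolvents -/

section Semigroup

variable {B : Type*} [NormedAddCommGroup B] [NormedSpace ℝ B]

lemma continuous_apply_comp {S : ℝ → B →L[ℝ] B} (hS : Continuous fun q : ℝ × B => S q.1 q.2)
    {X : Type*} [TopologicalSpace X] {a : X → ℝ} {b : X → B} (ha : Continuous a)
    (hb : Continuous b) : Continuous fun x => S (a x) (b x) :=
  hS.comp (ha.prodMk hb)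

lemma aestronglyMeasurable_apply_comp {S : ℝ → B →L[ℝ] B}
    (hS : Continuous fun q : ℝ × B => S q.1 q.2) {a : ℝ → ℝ} {b : ℝ → B} {ν : Measure ℝ}
    (ha : Continuous a) (hb : AEStronglyMeasurable b ν) :
    AEStronglyMeasurable (fun x => S (a x) (b x)) ν :=
  hS.comp_aestronglyMeasurable (ha.aestronglyMeasurable.prodMk hb)

namespace IsMAccretive

variable {A : B → B → Prop} [CompleteSpace B] (hA : IsMAccretive A)

include hA

/-- The function given by the Duhamel formula. -/
noncomputable def duhamel (u₀ : B) (h : ℝ → B) (t : ℝ) : B :=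
  hA.S t u₀ + ∫ s in (0 : ℝ)..t, hA.S (t - s) (h s)

lemma intervalIntegrable_S {h : ℝ → B} {a b : ℝ} (hh : IntervalIntegrable h volume a b) (t : ℝ) :
    IntervalIntegrable (fun s => hA.S (t - s) (h s)) volume a b := by
  refine hh.mono_fun ?_ (Eventually.of_forall fun s => hA.norm_S_le' _ _)
  exact aestronglyMeasurable_apply_comp hA.continuous_S (by fun_prop)
    (intervalIntegrable_iff.1 hh).aestronglyMeasurable

lemma duhamel_zero (u₀ : B) (h : ℝ → B) : hA.duhamel u₀ h 0 = u₀ := by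
  simp [duhamel, S_zero]

lemma norm_duhamel_le {u₀ : B} {h : ℝ → B} {t : ℝ} (ht : 0 ≤ t)
    (hh : IntervalIntegrable h volume 0 t) :
    ‖hA.duhamel u₀ h t‖ ≤ Real.exp (-t) * ‖u₀‖
      + ∫ s in (0 : ℝ)..t, Real.exp (-(t - s)) * ‖h s‖ := by
  refine (norm_add_le _ _).trans (add_le_add (hA.norm_S_le ht _) ?_)
  refine intervalIntegral.norm_integral_le_of_norm_le ht (Eventually.of_forall fun s hs =>
    hA.norm_S_le (sub_nonneg.2 hs.2) _) ?_
  exact hh.norm.continuousOn_mul (by fun_prop)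

lemma norm_duhamel_sub_le {u₀ u₁ : B} {h g : ℝ → B} {t : ℝ} (ht : 0 ≤ t)
    (hh : IntervalIntegrable h volume 0 t) (hg : IntervalIntegrable g volume 0 t) :
    ‖hA.duhamel u₀ h t - hA.duhamel u₁ g t‖ ≤ ‖u₀ - u₁‖ + ∫ s in (0 : ℝ)..t, ‖h s - g s‖ := by
  rw [duhamel, duhamel, add_sub_add_comm, ← map_sub, ← intervalIntegral.integral_sub
    (hA.intervalIntegrable_S hh t) (hA.intervalIntegrable_S hg t)]
  refine (norm_add_le _ _).trans (add_le_add (hA.norm_S_le' _ _) ?_)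
  refine intervalIntegral.norm_integral_le_of_norm_le ht (Eventually.of_forall fun s hs => ?_)
    (hh.sub hg).norm
  rw [← map_sub]
  exact hA.norm_S_le' _ _

lemma J_duhamel {l : ℝ} (hl : 0 < l) {u₀ : B} {h : ℝ → B} {t : ℝ}
    (hh : IntervalIntegrable h volume 0 t) :
    hA.J l (hA.duhamel u₀ h t) = hA.duhamel (hA.J l u₀) (fun s => hA.J l (h s)) t := by
  rw [duhamel, map_add, ← ContinuousLinearMap.intervalIntegral_comp_comm _
    (hA.intervalIntegrable_S hh t)]
  simp only [duhamel, hA.S_comm_J hl]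

lemma continuous_duhamel (u₀ : B) {g : ℝ → B} (hg : Continuous g) :
    Continuous (hA.duhamel u₀ g) := by
  refine (hA.continuous_S_apply u₀).add
    (intervalIntegral.continuous_parametric_intervalIntegral_of_continuous ?_ continuous_id)
  exact continuous_apply_comp hA.continuous_S (by fun_prop) (by fun_prop)

lemma duhamel_add (u₀ : B) {g : ℝ → B} (hg : Continuous g) {t d : ℝ} (ht : 0 ≤ t) (hd : 0 ≤ d) :
    hA.duhamel u₀ g (t + d) = hA.S d (hA.duhamel u₀ g t)
      + ∫ s in (0 : ℝ)..d, hA.S (d - s) (g (t + s)) := by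
  have hi : ∀ r a b, IntervalIntegrable (fun s => hA.S (r - s) (g s)) volume a b :=
    fun r a b => hA.intervalIntegrable_S (hg.intervalIntegrable a b) r
  have h1 : ∫ s in (0 : ℝ)..t, hA.S (t + d - s) (g s)
      = hA.S d (∫ s in (0 : ℝ)..t, hA.S (t - s) (g s)) := by
    rw [← ContinuousLinearMap.intervalIntegral_comp_comm _ (hi t 0 t)]
    refine intervalIntegral.integral_congr fun s hs => ?_
    rw [uIcc_of_le ht] at hs
    rw [← hA.S_add hd (sub_nonneg.2 hs.2)]
    congr 2
    ring
  have h2 : ∫ s in t..t + d, hA.S (t + d - s) (g s)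
      = ∫ s in (0 : ℝ)..d, hA.S (d - s) (g (t + s)) := by
    have := intervalIntegral.integral_comp_add_left (a := 0) (b := d)
      (fun s => hA.S (t + d - s) (g s)) t
    rw [add_zero] at this
    rw [← this]
    simp only [add_sub_add_left_eq_sub]
  rw [duhamel, duhamel, ← intervalIntegral.integral_add_adjacent_intervals (hi _ 0 t)
    (hi _ t (t + d)), h1, h2, map_add, add_comm t d, hA.S_add hd ht, add_assoc]

/-- The resolvent moves the Duhamel function `z` into the domain, where `-Y l (z t)` is the value of
the operator at `J l (z t)`. A right derivative is what the semigroup yields, and it is enough for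
the fundamental theorem of calculus. -/
lemma hasDerivWithinAt_J_duhamel (u₀ : B) {g : ℝ → B} (hg : Continuous g) {l t : ℝ} (hl : 0 < l)
    (ht : 0 ≤ t) :
    HasDerivWithinAt (fun t => hA.J l (hA.duhamel u₀ g t))
      (hA.J l (g t) + hA.Y l (hA.duhamel u₀ g t)) (Ioi t) t := by
  rw [hasDerivWithinAt_iff_tendsto_slope' self_notMem_Ioi]
  have hsub : Tendsto (fun y : ℝ => y - t) (𝓝[>] t) (𝓝[>] 0) := by
    refine tendsto_nhdsWithin_iff.2 ⟨?_, ?_⟩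
    · have : Tendsto (fun y : ℝ => y - t) (𝓝 t) (𝓝 (t - t)) := Continuous.tendsto (by fun_prop) t
      rw [sub_self] at this
      exact this.mono_left nhdsWithin_le_nhds
    · filter_upwards [self_mem_nhdsWithin] with y hy using sub_pos.2 (mem_Ioi.1 hy)
  set z := hA.duhamel u₀ g t
  have h1 := ((hA.tendsto_generator (hA.J_graph hl z)).comp hsub).neg
  rw [neg_neg] at h1
  -- The mean of the new Duhamel term over a step of length `d`, rescaled to the unit interval so
  -- that it is continuous in `d` up to `d = 0`.
  have h2 : Tendsto (fun d : ℝ => ∫ s in (0 : ℝ)..1, hA.S (d - d * s) (g (t + d * s))) (𝓝 0)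
      (𝓝 (g t)) := by
    have hc : Continuous (fun d : ℝ => ∫ s in (0 : ℝ)..1, hA.S (d - d * s) (g (t + d * s))) :=
      intervalIntegral.continuous_parametric_intervalIntegral_of_continuous
        (f := fun d s => hA.S (d - d * s) (g (t + d * s)))
        (continuous_apply_comp hA.continuous_S (by fun_prop) (by fun_prop)) continuous_const
    simpa [S_zero] using hc.tendsto 0
  have h3 := ((hA.J l).continuous.tendsto _).comp
    (h2.comp (hsub.mono_right nhdsWithin_le_nhds))
  refine (h3.add h1).congr' ?_
  filter_upwards [self_mem_nhdsWithin] with y hy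
  have hy : 0 < y - t := sub_pos.2 hy
  have h4 := hA.duhamel_add u₀ hg ht hy.le
  rw [add_sub_cancel] at h4
  have h5 := intervalIntegral.integral_comp_mul_left (a := 0) (b := 1)
    (fun s => hA.S (y - t - s) (g (t + s))) hy.ne'
  rw [mul_zero, mul_one] at h5
  simp only [Function.comp, slope, vsub_eq_sub, h4, h5, map_add, map_smul]
  rw [add_sub_assoc, add_comm, ← hA.S_comm_J hl, ← smul_neg, neg_sub, ← smul_add]
  congr 1
  abel

lemma J_duhamel_sub (u₀ : B) {g : ℝ → B} (hg : Continuous g) {l a b : ℝ} (hl : 0 < l)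
    (ha : 0 ≤ a) (hab : a ≤ b) :
    hA.J l (hA.duhamel u₀ g b) - hA.J l (hA.duhamel u₀ g a)
      = ∫ r in a..b, (hA.J l (g r) + hA.Y l (hA.duhamel u₀ g r)) := by
  have hc := hA.continuous_duhamel u₀ hg
  refine (intervalIntegral.integral_eq_sub_of_hasDeriv_right_of_le hab
    (((hA.J l).continuous.comp hc).continuousOn) (fun x hx =>
      hA.hasDerivWithinAt_J_duhamel u₀ hg hl (ha.trans hx.1.le)) ?_).symm
  exact (((hA.J l).continuous.comp hg).add ((hA.Y l).continuous.comp hc)).intervalIntegrable _ _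

-- The data `(u₀, h)` are replaced by `(J l u₀, J l ∘ g)`. The continuous `g` is fixed first and
-- then `l` is taken small, because `J l` converges only strongly.
omit [CompleteSpace B] in
lemma exists_nice_approx (u₀ : B) {h : ℝ → B} {T : ℝ} (hT : 0 ≤ T)
    (hh : IntervalIntegrable h volume 0 T) {ε : ℝ} (hε : 0 < ε) :
    ∃ g : ℝ → B, Continuous g ∧ (∫ s in (0 : ℝ)..T, ‖h s - g s‖) ≤ ε ∧ ∃ l > 0,
      ‖u₀ - hA.J l u₀‖ ≤ ε ∧ (∫ s in (0 : ℝ)..T, ‖h s - hA.J l (g s)‖) ≤ ε := by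
  obtain ⟨g, hg, -⟩ := ((intervalIntegrable_iff_integrableOn_Ioc_of_le hT).1
    hh).exists_boundedContinuous_integral_sub_le (ε := ε / 2) (by positivity)
  rw [← intervalIntegral.integral_of_le hT] at hg
  have hgi := g.continuous.intervalIntegrable (μ := volume) 0 T
  have h1 : Tendsto (fun l => ∫ s in (0 : ℝ)..T, ‖g s - hA.J l (g s)‖) (𝓝[>] 0)
      (𝓝 (∫ s in (0 : ℝ)..T, ‖g s - g s‖)) := by
    refine intervalIntegral.tendsto_integral_filter_of_dominated_convergence
      (fun s => 2 * ‖g s‖) ?_ ?_ (by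
        exact (continuous_const.mul g.continuous.norm).intervalIntegrable _ _) ?_
    · exact Eventually.of_forall fun l =>
        (g.continuous.sub ((hA.J l).continuous.comp g.continuous)).norm.aestronglyMeasurable
    · filter_upwards [self_mem_nhdsWithin] with l hl
      refine Eventually.of_forall fun s _ => ?_
      rw [norm_norm]
      have := norm_sub_le (g s) (hA.J l (g s))
      have := hA.norm_J_le' hl (g s)
      linarith
    · exact Eventually.of_forall fun s _ => ((hA.tendsto_J (g s)).const_sub (g s)).norm
  have h2 : Tendsto (fun l => ‖u₀ - hA.J l u₀‖) (𝓝[>] 0) (𝓝 ‖u₀ - u₀‖) :=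
    ((hA.tendsto_J u₀).const_sub u₀).norm
  simp only [sub_self, norm_zero, intervalIntegral.integral_zero] at h1 h2
  obtain ⟨l, ⟨hl1, hl2⟩, hl⟩ := (((h1.eventually_lt_const (half_pos hε)).and
    (h2.eventually_lt_const hε)).and self_mem_nhdsWithin).exists
  refine ⟨g, g.continuous, by linarith, l, hl, hl2.le, ?_⟩
  have hJi : IntervalIntegrable (fun s => hA.J l (g s)) volume 0 T :=
    ((hA.J l).continuous.comp g.continuous).intervalIntegrable _ _
  calc _ ≤ ∫ s in (0 : ℝ)..T, (‖h s - g s‖ + ‖g s - hA.J l (g s)‖) := by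
        refine intervalIntegral.integral_mono_on hT (hh.sub hJi).norm
          ((hh.sub hgi).norm.add (hgi.sub hJi).norm) fun s _ => ?_
        exact norm_sub_le_norm_sub_add_norm_sub _ _ _
    _ = (∫ s in (0 : ℝ)..T, ‖h s - g s‖) + ∫ s in (0 : ℝ)..T, ‖g s - hA.J l (g s)‖ :=
        intervalIntegral.integral_add (hh.sub hgi).norm (hgi.sub hJi).norm
    _ ≤ ε := by linarith

omit [NormedSpace ℝ B] hA [CompleteSpace B] in
lemma _root_.IntervalIntegrable.mono_Icc {h : ℝ → B} {T a b : ℝ}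
    (hh : IntervalIntegrable h volume 0 T) (ha : 0 ≤ a) (hab : a ≤ b) (hb : b ≤ T) :
    IntervalIntegrable h volume a b := by
  refine hh.mono_set ?_
  rw [uIcc_of_le hab, uIcc_of_le (ha.trans (hab.trans hb))]
  exact Icc_subset_Icc ha hb

lemma continuousOn_duhamel (u₀ : B) {h : ℝ → B} {T : ℝ} (hT : 0 ≤ T)
    (hh : IntervalIntegrable h volume 0 T) : ContinuousOn (hA.duhamel u₀ h) (Icc 0 T) := by
  refine continuousOn_of_uniform_approx_of_continuousOn fun U hU => ?_
  obtain ⟨ε, hε, hU⟩ := Metric.mem_uniformity_dist.1 hU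
  obtain ⟨g, hg, hgh, -⟩ := hA.exists_nice_approx u₀ hT hh (half_pos hε)
  refine ⟨_, (hA.continuous_duhamel u₀ hg).continuousOn, fun t ht => hU ?_⟩
  rw [dist_eq_norm]
  have hgi := hg.intervalIntegrable (μ := volume) 0 T
  refine (hA.norm_duhamel_sub_le ht.1 (hh.mono_Icc le_rfl ht.1 ht.2)
    (hg.intervalIntegrable _ _)).trans_lt ?_
  rw [sub_self, norm_zero, zero_add]
  refine (intervalIntegral.integral_mono_interval le_rfl ht.1 ht.2
    (Eventually.of_forall fun s => norm_nonneg _) (hh.sub hgi).norm).trans_lt ?_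
  linarith

end IsMAccretive
end Semigroup

/-! ### Discretizations and mild solutions -/

section Mild

variable {B : Type*} [NormedAddCommGroup B] [NormedSpace ℝ B]

omit [NormedSpace ℝ B] in
lemma IsDiscretization.mono {T : ℝ} {h : ℝ → B} {ε ε' : ℝ} {N : ℕ} {t : ℕ → ℝ} {hd : ℕ → B}
    (H : IsDiscretization T h ε N t hd) (hε : ε ≤ ε') : IsDiscretization T h ε' N t hd :=
  ⟨H.zero, H.lt, H.le, fun k hk => (H.mesh k hk).trans hε, H.last.trans hε, H.err.trans hε⟩

omit [NormedSpace ℝ B] in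
lemma IsDiscretization.le_of_le {T : ℝ} {h : ℝ → B} {ε : ℝ} {N : ℕ} {t : ℕ → ℝ} {hd : ℕ → B}
    (H : IsDiscretization T h ε N t hd) {j k : ℕ} (hjk : j ≤ k) (hk : k ≤ N) : t j ≤ t k := by
  induction k, hjk using Nat.le_induction with
  | base => exact le_rfl
  | succ k hjk ih => exact (ih (by omega)).trans (H.lt k (by omega)).le

omit [NormedSpace ℝ B] in
lemma IsDiscretization.mem {T : ℝ} {h : ℝ → B} {ε : ℝ} {N : ℕ} {t : ℕ → ℝ} {hd : ℕ → B}
    (H : IsDiscretization T h ε N t hd) {k : ℕ} (hk : k ≤ N) : t k ∈ Icc 0 T :=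
  ⟨H.zero ▸ H.le_of_le (Nat.zero_le k) hk, (H.le_of_le hk le_rfl).trans H.le⟩

omit [NormedSpace ℝ B] in
lemma IsDiscretization.exists_mem {T : ℝ} {h : ℝ → B} {ε : ℝ} {N : ℕ} {t : ℕ → ℝ} {hd : ℕ → B}
    (H : IsDiscretization T h ε N t hd) {s : ℝ} (hs : 0 < s) (hsN : s ≤ t N) :
    ∃ k < N, s ∈ Ioc (t k) (t (k + 1)) := by
  classical
  have hex : ∃ m, s ≤ t m := ⟨N, hsN⟩
  have h1 := Nat.find_spec hex
  have h2 : Nat.find hex ≤ N := Nat.find_min' hex hsN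
  rcases hm : Nat.find hex with _ | m
  · rw [hm, H.zero] at h1
    linarith
  · rw [hm] at h1 h2
    exact ⟨m, by omega, not_le.1 (Nat.find_min hex (by omega)), h1⟩

/-- Uniform grids give discretizations that are as fine as one likes. -/
lemma exists_isDiscretization {h : ℝ → B} {T : ℝ} (hT : 0 < T)
    (hh : IntervalIntegrable h volume 0 T) {ε : ℝ} (hε : 0 < ε) :
    ∃ N t hd, IsDiscretization T h ε N t hd ∧ t N = T := by
  obtain ⟨g, hg, -⟩ := ((intervalIntegrable_iff_integrableOn_Ioc_of_le hT.le).1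
    hh).exists_boundedContinuous_integral_sub_le (ε := ε / 2) (by positivity)
  rw [← intervalIntegral.integral_of_le hT.le] at hg
  -- Half of `ε` pays for replacing `h` by `g` in `L^1`; an oscillation of `g` below `ε / (2T)` per
  -- cell costs the other half over `[0, T]`.
  obtain ⟨δ, hδ, hδg⟩ := Metric.uniformContinuousOn_iff.1
    ((isCompact_Icc (a := 0) (b := T)).uniformContinuousOn_of_continuous
      g.continuous.continuousOn) (ε / (2 * T)) (by positivity)
  obtain ⟨n, hn⟩ := exists_nat_gt (max (T / δ) (T / ε))
  have hn1 := (le_max_left _ _).trans_lt hn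
  have hn2 := (le_max_right _ _).trans_lt hn
  have hn0 : (0 : ℝ) < n := (by positivity : 0 < T / ε).trans hn2
  rw [div_lt_iff₀ (by positivity)] at hn1 hn2
  let t : ℕ → ℝ := fun k => k * (T / n)
  have ht : ∀ k, t (k + 1) - t k = T / n := fun k => by simp only [t]; push_cast; ring
  have htT : t n = T := by simp only [t]; field_simp
  have hlt : ∀ k, t k < t (k + 1) := fun k => by
    have : 0 < T / n := by positivity
    linarith [ht k]
  have htk : ∀ k ≤ n, t k ∈ Icc 0 T := fun k hk =>
    ⟨by positivity, htT ▸ monotone_nat_of_le_succ (fun k => (hlt k).le) hk⟩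
  have hmeshδ : T / n < δ := by rwa [div_lt_iff₀ hn0, mul_comm]
  have hmeshε : T / n ≤ ε := by rw [div_le_iff₀ hn0, mul_comm]; exact hn2.le
  refine ⟨n, t, fun k => g (t k), ⟨by simp [t], fun k _ => hlt k, htT.le,
    fun k _ => (ht k).trans_le hmeshε, by rw [htT, sub_self]; exact hε.le, ?_⟩, htT⟩
  have hgi : ∀ a b, IntervalIntegrable g volume a b := fun a b => g.continuous.intervalIntegrable a b
  have hhk : ∀ k < n, IntervalIntegrable h volume (t k) (t (k + 1)) := fun k hk =>
    hh.mono_Icc (htk k hk.le).1 (hlt k).le (htk (k + 1) hk).2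
  have hsub : ∀ k < n, IntervalIntegrable (fun s => ‖h s - g s‖ + ε / (2 * T)) volume
      (t k) (t (k + 1)) := fun k hk =>
    ((hhk k hk).sub (hgi _ _)).norm.add intervalIntegrable_const
  calc ∑ k ∈ Finset.range n, ∫ s in t k..t (k + 1), ‖h s - g (t (k + 1))‖
      ≤ ∑ k ∈ Finset.range n, ∫ s in t k..t (k + 1), (‖h s - g s‖ + ε / (2 * T)) := by
        refine Finset.sum_le_sum fun k hk => ?_
        rw [Finset.mem_range] at hk
        refine intervalIntegral.integral_mono_on (hlt k).le
          ((hhk k hk).sub intervalIntegrable_const).norm (hsub k hk) fun s hs => ?_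
        refine (norm_sub_le_norm_sub_add_norm_sub _ (g s) _).trans ?_
        gcongr
        rw [← dist_eq_norm]
        refine (hδg s ⟨(htk k hk.le).1.trans hs.1, hs.2.trans (htk (k + 1) hk).2⟩ _
          (htk (k + 1) hk) ?_).le
        rw [Real.dist_eq, abs_lt]
        constructor <;> linarith [hs.1, hs.2, ht k, hlt k]
    _ = ∫ s in (0 : ℝ)..T, (‖h s - g s‖ + ε / (2 * T)) := by
        rw [intervalIntegral.sum_integral_adjacent_intervals hsub, htT]
        simp [t]
    _ = (∫ s in (0 : ℝ)..T, ‖h s - g s‖) + ε / 2 := by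
        rw [intervalIntegral.integral_add (hh.sub (hgi _ _)).norm intervalIntegrable_const]
        simp only [intervalIntegral.integral_const, sub_zero, smul_eq_mul]
        field_simp
    _ ≤ ε := by linarith

lemma IsMildOn.mono {A A' : B → B → Prop} (hAA : ∀ u v, A u v → A' u v) {h : ℝ → B} {u₀ : B}
    {T : ℝ} {u : ℝ → B} (hu : IsMildOn A h u₀ T u) : IsMildOn A' h u₀ T u := by
  refine ⟨hu.1, fun ε hε => ?_⟩
  obtain ⟨N, t, hd, ud, h1, ⟨h2, h3⟩, h4⟩ := hu.2 ε hε
  refine ⟨N, t, hd, ud, h1, ⟨h2, fun k hk => ?_⟩, h4⟩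
  obtain ⟨v, hv, e⟩ := h3 k hk
  exact ⟨v, hAA _ _ hv, e⟩

lemma IsMild.mono {A A' : B → B → Prop} (hAA : ∀ u v, A u v → A' u v) {h : ℝ → B} {u₀ : B}
    {T : ℝ≥0∞} {u : ℝ → B} (hu : IsMild A h u₀ T u) : IsMild A' h u₀ T u :=
  ⟨fun hT => (hu.1 hT).mono hAA, fun hT a ha => (hu.2 hT a ha).mono hAA⟩

/-! ### Implicit Euler schemes against the Duhamel function -/

namespace IsMAccretive

variable {A : B → B → Prop} (hA : IsMAccretive A)

include hA

lemma exists_isEuler (u₀ : B) {N : ℕ} {t : ℕ → ℝ} (ht : ∀ k < N, t k < t (k + 1)) (hd : ℕ → B) :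
    ∃ ud, IsEuler A u₀ N t hd ud := by
  let ud : ℕ → B := fun k => Nat.rec u₀ (fun k w =>
    hA.J (t (k + 1) - t k) (w + (t (k + 1) - t k) • hd (k + 1))) k
  refine ⟨ud, rfl, fun k hk => ⟨_, hA.J_graph (sub_pos.2 (ht k hk)) _, ?_⟩⟩
  rw [smul_neg, ← sub_eq_add_neg, hA.J_sub_smul_Y (sub_pos.2 (ht k hk))]

variable [CompleteSpace B]

/-- Subtracting the Euler step from the integrated equation for `J l ∘ z` puts the new error, plus a
step of the operator applied to it, on one side; accretivity removes the operator. What remains is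
the old error, the two forcing errors, and the cost `η` per unit time of freezing `Y l ∘ z` at the
right endpoint. -/
lemma norm_euler_step_le (u₀ : B) {g : ℝ → B} (hg : Continuous g) {h : ℝ → B} {l a b η : ℝ}
    (hl : 0 < l) (ha : 0 ≤ a) (hab : a < b) (hh : IntervalIntegrable h volume a b) {c u u' v' : B}
    (hv : A u' v') (hu : u' + (b - a) • v' = u + (b - a) • c)
    (hη : ∀ r ∈ Icc a b, ‖hA.Y l (hA.duhamel u₀ g r) - hA.Y l (hA.duhamel u₀ g b)‖ ≤ η) :
    ‖hA.J l (hA.duhamel u₀ g b) - u'‖ ≤ ‖hA.J l (hA.duhamel u₀ g a) - u‖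
      + ((∫ r in a..b, ‖h r - hA.J l (g r)‖) + (∫ r in a..b, ‖h r - c‖) + (b - a) * η) := by
  set z := hA.duhamel u₀ g
  have hz : Continuous z := hA.continuous_duhamel u₀ hg
  have hab' : 0 < b - a := sub_pos.2 hab
  have h1 := hA.accretive (hA.sub (hA.J_graph hl (z b)) hv) hab'
  have hJi : IntervalIntegrable (fun r => hA.J l (g r)) volume a b :=
    ((hA.J l).continuous.comp hg).intervalIntegrable _ _
  have hYi : IntervalIntegrable (fun r => hA.Y l (z r)) volume a b :=
    ((hA.Y l).continuous.comp hz).intervalIntegrable _ _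
  have h2 : hA.J l (z b) - u' + (b - a) • (-hA.Y l (z b) - v')
      = hA.J l (z a) - u + ∫ r in a..b, (hA.J l (g r) + hA.Y l (z r) - (hA.Y l (z b) + c)) := by
    rw [intervalIntegral.integral_sub (hJi.add hYi) intervalIntegrable_const,
      ← hA.J_duhamel_sub u₀ hg hl ha hab.le, intervalIntegral.integral_const]
    have h3 : u = u' + (b - a) • v' - (b - a) • c := by rw [hu]; abel
    change _ = hA.J l (z a) - u + (hA.J l (z b) - hA.J l (z a) - (b - a) • (hA.Y l (z b) + c))
    rw [h3, smul_sub, smul_neg, smul_add]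
    abel
  rw [h2] at h1
  have h3 : ‖∫ r in a..b, (hA.J l (g r) + hA.Y l (z r) - (hA.Y l (z b) + c))‖
      ≤ ∫ r in a..b, (‖h r - hA.J l (g r)‖ + ‖h r - c‖ + η) := by
    refine intervalIntegral.norm_integral_le_of_norm_le hab.le (Eventually.of_forall fun r hr => ?_)
      (((hh.sub hJi).norm.add (hh.sub intervalIntegrable_const).norm).add intervalIntegrable_const)
    have e : hA.J l (g r) + hA.Y l (z r) - (hA.Y l (z b) + c)
        = -(h r - hA.J l (g r)) + (h r - c) + (hA.Y l (z r) - hA.Y l (z b)) := by abel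
    rw [e]
    refine (norm_add_le _ _).trans (add_le_add ((norm_add_le _ _).trans_eq ?_)
      (hη r ⟨hr.1.le, hr.2⟩))
    rw [norm_neg]
  rw [intervalIntegral.integral_add ((hh.sub hJi).norm.add (hh.sub intervalIntegrable_const).norm)
      intervalIntegrable_const,
    intervalIntegral.integral_add (hh.sub hJi).norm (hh.sub intervalIntegrable_const).norm,
    intervalIntegral.integral_const, smul_eq_mul] at h3
  have h4 := norm_add_le (hA.J l (z a) - u)
    (∫ r in a..b, (hA.J l (g r) + hA.Y l (z r) - (hA.Y l (z b) + c)))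
  have h5 : ‖hA.J l (z b) - u'‖ ≤ (1 + (b - a)) * ‖hA.J l (z b) - u'‖ :=
    le_mul_of_one_le_left (norm_nonneg _) (by linarith)
  linarith

lemma exists_norm_euler_sub_duhamel_le (u₀ : B) {h : ℝ → B} {T : ℝ} (hT : 0 < T)
    (hh : IntervalIntegrable h volume 0 T) {η : ℝ} (hη : 0 < η) :
    ∃ δ > 0, ∀ N t hd ud, IsDiscretization T h δ N t hd → IsEuler A u₀ N t hd ud →
      ∀ k ≤ N, ‖ud k - hA.duhamel u₀ h (t k)‖ ≤ η := by
  -- Six errors of size `η / 6`: those of `u₀` and of `h` are paid twice, once from the scheme to `J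
  -- l ∘ z` and once from there to the Duhamel function of `(u₀, h)`. The forcing error of the
  -- scheme and the freezing error are paid once.
  obtain ⟨g, hg, -, l, hl, hu, hgl⟩ := hA.exists_nice_approx u₀ hT.le hh (ε := η / 6) (by positivity)
  set z := hA.duhamel u₀ g with hz_def
  have hz : Continuous z := hA.continuous_duhamel u₀ hg
  obtain ⟨δ, hδ, hδz⟩ := Metric.uniformContinuousOn_iff.1
    ((isCompact_Icc (a := 0) (b := T)).uniformContinuousOn_of_continuous
      ((hA.Y l).continuous.comp hz).continuousOn) (η / (6 * T)) (by positivity)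
  refine ⟨min (δ / 2) (η / 6), by positivity, fun N t hd ud hD hE k hk => ?_⟩
  have hJc : Continuous (fun r => hA.J l (g r)) := (hA.J l).continuous.comp hg
  have hmain : ∀ k ≤ N, ‖hA.J l (z (t k)) - ud k‖ ≤ ‖u₀ - hA.J l u₀‖
      + ((∫ r in (0 : ℝ)..t k, ‖h r - hA.J l (g r)‖)
        + (∑ j ∈ Finset.range k, ∫ r in t j..t (j + 1), ‖h r - hd (j + 1)‖)
        + t k * (η / (6 * T))) := by
    intro k
    induction k with
    | zero =>
      intro _
      rw [hD.zero, hE.1, hz_def, duhamel_zero, norm_sub_rev]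
      simp
    | succ k ih =>
      intro hk
      have hk' : k < N := hk
      obtain ⟨v, hv, e⟩ := hE.2 k hk'
      have hk0 := hD.mem hk'.le
      have hk1 := hD.mem hk
      have hlt := hD.lt k hk'
      have h1 := hA.norm_euler_step_le (η := η / (6 * T)) u₀ hg hl hk0.1 hlt
        (hh.mono_Icc hk0.1 hlt.le hk1.2) hv e (fun r hr => by
          rw [← dist_eq_norm]
          refine (hδz r ⟨hk0.1.trans hr.1, hr.2.trans hk1.2⟩ _ hk1 ?_).le
          have := (hD.mesh k hk').trans (min_le_left _ _)
          rw [Real.dist_eq, abs_lt]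
          constructor <;> linarith [hr.1, hr.2])
      have h2 := ih hk'.le
      have h3 := intervalIntegral.integral_add_adjacent_intervals (μ := volume)
        (f := fun r => ‖h r - hA.J l (g r)‖) (a := 0) (b := t k) (c := t (k + 1))
        (((hh.mono_Icc le_rfl hk0.1 hk0.2).sub (hJc.intervalIntegrable _ _)).norm)
        (((hh.mono_Icc hk0.1 hlt.le hk1.2).sub (hJc.intervalIntegrable _ _)).norm)
      rw [Finset.sum_range_succ, ← h3]
      linarith
  have htk := hD.mem hk
  have hhk := hh.mono_Icc le_rfl htk.1 htk.2
  have h1 := hmain k hk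
  have h2 : (∫ r in (0 : ℝ)..t k, ‖h r - hA.J l (g r)‖) ≤ η / 6 :=
    (intervalIntegral.integral_mono_interval le_rfl htk.1 htk.2
      (Eventually.of_forall fun s => norm_nonneg _)
      (hh.sub (hJc.intervalIntegrable _ _)).norm).trans hgl
  have h3 : ∑ j ∈ Finset.range k, ∫ r in t j..t (j + 1), ‖h r - hd (j + 1)‖ ≤ η / 6 := by
    refine (Finset.sum_le_sum_of_subset_of_nonneg (Finset.range_mono hk) fun j hj _ => ?_).trans
      (hD.err.trans (min_le_right _ _))
    exact intervalIntegral.integral_nonneg (hD.lt j (Finset.mem_range.1 hj)).le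
      fun _ _ => norm_nonneg _
  have h4 : t k * (η / (6 * T)) ≤ η / 6 := by
    calc t k * (η / (6 * T)) ≤ T * (η / (6 * T)) := by gcongr; exact htk.2
      _ = η / 6 := by field_simp
  have h5 := hA.norm_duhamel_sub_le (u₀ := u₀) (u₁ := hA.J l u₀) htk.1 hhk
    (hJc.intervalIntegrable _ _)
  rw [← hA.J_duhamel hl (hg.intervalIntegrable _ _)] at h5
  have h6 := norm_sub_le_norm_sub_add_norm_sub (hA.duhamel u₀ h (t k)) (hA.J l (z (t k))) (ud k)
  rw [norm_sub_rev]
  linarith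

lemma exists_euler_close (u₀ : B) {h : ℝ → B} {T : ℝ} (hT : 0 < T)
    (hh : IntervalIntegrable h volume 0 T) {η : ℝ} (hη : 0 < η) :
    ∃ δ > 0, ∀ N t hd ud, IsDiscretization T h δ N t hd → IsEuler A u₀ N t hd ud →
      ∀ k < N, ∀ s ∈ Ioc (t k) (t (k + 1)), ‖hA.duhamel u₀ h s - ud (k + 1)‖ < η := by
  obtain ⟨δ₁, hδ₁, H₁⟩ := hA.exists_norm_euler_sub_duhamel_le u₀ hT hh (half_pos hη)
  obtain ⟨δ₂, hδ₂, H₂⟩ := Metric.uniformContinuousOn_iff.1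
    (isCompact_Icc.uniformContinuousOn_of_continuous (hA.continuousOn_duhamel u₀ hT.le hh)) (η / 2)
    (half_pos hη)
  refine ⟨min δ₁ (δ₂ / 2), by positivity, fun N t hd ud hD hE k hk s hs => ?_⟩
  have h1 := H₁ N t hd ud (hD.mono (min_le_left _ _)) hE (k + 1) hk
  have hk1 := hD.mem (Nat.succ_le_of_lt hk)
  have h2 := H₂ s ⟨(hD.mem hk.le).1.trans hs.1.le, hs.2.trans hk1.2⟩ _ hk1 (by
    have := (hD.mesh k hk).trans (min_le_right _ _)
    rw [Real.dist_eq, abs_lt]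
    constructor <;> linarith [hs.1, hs.2])
  rw [dist_eq_norm] at h2
  rw [norm_sub_rev] at h1
  linarith [norm_sub_le_norm_sub_add_norm_sub (hA.duhamel u₀ h s) (hA.duhamel u₀ h (t (k + 1)))
    (ud (k + 1))]

lemma isMildOn_duhamel (u₀ : B) {h : ℝ → B} {T : ℝ} (hT : 0 < T)
    (hh : IntervalIntegrable h volume 0 T) : IsMildOn A h u₀ T (hA.duhamel u₀ h) := by
  refine ⟨hA.continuousOn_duhamel u₀ hT.le hh, fun ε hε => ?_⟩
  obtain ⟨δ, hδ, H⟩ := hA.exists_euler_close u₀ hT hh hε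
  obtain ⟨N, t, hd, hD, -⟩ := exists_isDiscretization hT hh (lt_min hδ hε)
  obtain ⟨ud, hE⟩ := hA.exists_isEuler u₀ hD.lt hd
  refine ⟨N, t, hd, ud, hD.mono (min_le_right _ _), hE, ?_,
    H N t hd ud (hD.mono (min_le_left _ _)) hE⟩
  rwa [duhamel_zero, sub_self, norm_zero]

lemma eqOn_duhamel_of_isMildOn {u₀ : B} {h : ℝ → B} {T : ℝ} (hT : 0 < T)
    (hh : IntervalIntegrable h volume 0 T) {v : ℝ → B} (hv : IsMildOn A h u₀ T v) :
    EqOn v (hA.duhamel u₀ h) (Icc 0 T) := by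
  have hI : EqOn v (hA.duhamel u₀ h) (Ioo 0 T) := by
    intro s hs
    refine eq_of_forall_dist_le fun η hη => ?_
    obtain ⟨δ, hδ, H⟩ := hA.exists_euler_close u₀ hT hh (half_pos hη)
    -- A scheme may stop before `T`; accuracy `T - s` ensures that `s ≤ t N`. The endpoints of `[0,
    -- T]` follow by continuity.
    obtain ⟨N, t, hd, ud, hD, hE, -, hud⟩ := hv.2 (min δ (min (η / 2) (T - s)))
      (lt_min hδ (lt_min (half_pos hη) (sub_pos.2 hs.2)))
    have hle := (min_le_right δ (min (η / 2) (T - s)))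
    obtain ⟨k, hk, hsk⟩ := hD.exists_mem hs.1 (by
      have := hD.last.trans (hle.trans (min_le_right _ _))
      linarith)
    have h1 := H N t hd ud (hD.mono (min_le_left _ _)) hE k hk s hsk
    have h2 := (hud k hk s hsk).trans_le (hle.trans (min_le_left _ _))
    rw [norm_sub_rev] at h1
    rw [dist_eq_norm]
    linarith [norm_sub_le_norm_sub_add_norm_sub (v s) (ud (k + 1)) (hA.duhamel u₀ h s)]
  exact hI.of_subset_closure hv.1 (hA.continuousOn_duhamel u₀ hT.le hh) Ioo_subset_Icc_self
    (closure_Ioo hT.ne).ge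

lemma isMild_duhamel (u₀ : B) {h : ℝ → B} {T : ℝ≥0∞} (hT : 0 < T)
    (hh : ∀ t ∈ timeInterval T, IntervalIntegrable h volume 0 t) :
    IsMild A h u₀ T (hA.duhamel u₀ h) :=
  ⟨fun hT' => hA.isMildOn_duhamel u₀ (ENNReal.toReal_pos hT.ne' hT') (hh _
      ⟨ENNReal.toReal_nonneg, (ENNReal.ofReal_toReal hT').le⟩),
    fun hT' _ ha => hA.isMildOn_duhamel u₀ ha (hh _ ⟨ha.le, hT' ▸ le_top⟩)⟩

lemma eqOn_duhamel_of_isMild {u₀ : B} {h : ℝ → B} {T : ℝ≥0∞} (hT : 0 < T)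
    (hh : ∀ t ∈ timeInterval T, IntervalIntegrable h volume 0 t) {v : ℝ → B}
    (hv : IsMild A h u₀ T v) : EqOn v (hA.duhamel u₀ h) (timeInterval T) := by
  intro s hs
  by_cases hT' : T = ∞
  · have h1 : 0 < s + 1 := by linarith [hs.1]
    exact hA.eqOn_duhamel_of_isMildOn h1 (hh _ ⟨h1.le, hT' ▸ le_top⟩) (hv.2 hT' _ h1)
      ⟨hs.1, by linarith⟩
  · exact hA.eqOn_duhamel_of_isMildOn (ENNReal.toReal_pos hT.ne' hT') (hh _
      ⟨ENNReal.toReal_nonneg, (ENNReal.ofReal_toReal hT').le⟩) (hv.1 hT')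
      ⟨hs.1, (ENNReal.ofReal_le_iff_le_toReal hT').1 hs.2⟩

end IsMAccretive

omit [NormedSpace ℝ B] in
lemma intervalIntegrable_of_timeInterval {h : ℝ → B} {T : ℝ≥0∞}
    (hh : LocallyIntegrableOn h (timeInterval T)) {t : ℝ} (ht : t ∈ timeInterval T) :
    IntervalIntegrable h volume 0 t := by
  rw [intervalIntegrable_iff_integrableOn_Icc_of_le ht.1]
  refine hh.integrableOn_compact_subset (fun s hs => ?_) isCompact_Icc
  exact ⟨hs.1, (ENNReal.ofReal_le_ofReal hs.2).trans ht.2⟩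

end Mild

namespace WGraph

variable {X : Type*}

/-! ### Pointwise calculus and truncation in `ℓ^p` -/

section Ell

variable [Countable X] (G : WGraph X) {p : ℝ≥0∞}

lemma ell_add_apply (u v : G.ell p) (x : X) : (u + v) x = u x + v x :=
  (G.ae_nodeMeasure_iff _).1 (Lp.coeFn_add u v) x

lemma ell_sub_apply (u v : G.ell p) (x : X) : (u - v) x = u x - v x :=
  (G.ae_nodeMeasure_iff _).1 (Lp.coeFn_sub u v) x

lemma ell_zero_apply (x : X) : (0 : G.ell p) x = 0 :=
  (G.ae_nodeMeasure_iff _).1 (Lp.coeFn_zero ℝ p G.nodeMeasure) x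

lemma ell_smul_apply (c : ℝ) (u : G.ell p) (x : X) : (c • u) x = c * u x :=
  (G.ae_nodeMeasure_iff _).1 (Lp.coeFn_smul c u) x

omit [Countable X] in
lemma lintegral_nodeMeasure (φ : X → ℝ≥0∞) :
    ∫⁻ x, φ x ∂G.nodeMeasure = ∑' x, ENNReal.ofReal (G.mu x) * φ x := by
  let _ : MeasurableSpace X := ⊤
  unfold nodeMeasure
  rw [lintegral_sum_measure]
  refine tsum_congr fun x => ?_
  rw [lintegral_smul_measure, lintegral_dirac, smul_eq_mul]

variable [hp1 : Fact (1 ≤ p)] (hp : p ≠ ∞)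

omit [Countable X] in
include hp in
lemma one_le_toReal : 1 ≤ p.toReal := by
  rw [← ENNReal.toReal_one]
  exact ENNReal.toReal_mono hp hp1.out

omit [Countable X] in
include hp in
lemma memLp_iff (φ : X → ℝ) :
    MemLp φ p G.nodeMeasure ↔ Summable fun x => |φ x| ^ p.toReal * G.mu x := by
  let _ : MeasurableSpace X := ⊤
  have hp0 : p ≠ 0 := (zero_lt_one.trans_le hp1.out).ne'
  have hm : AEStronglyMeasurable φ G.nodeMeasure := measurable_from_top.aestronglyMeasurable
  have e : ∀ x, ENNReal.ofReal (G.mu x) * ‖φ x‖ₑ ^ p.toReal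
      = ENNReal.ofReal (|φ x| ^ p.toReal * G.mu x) := by
    intro x
    rw [Real.enorm_eq_ofReal_abs, ENNReal.ofReal_rpow_of_nonneg (abs_nonneg _)
      ENNReal.toReal_nonneg, ← ENNReal.ofReal_mul (G.mu_pos x).le, mul_comm]
  have h0 : ∀ x, 0 ≤ |φ x| ^ p.toReal * G.mu x := fun x =>
    mul_nonneg (Real.rpow_nonneg (abs_nonneg _) _) (G.mu_pos x).le
  rw [MemLp, and_iff_right hm, eLpNorm_lt_top_iff_lintegral_rpow_enorm_lt_top hp0 hp,
    lintegral_nodeMeasure]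
  simp_rw [e]
  constructor
  · intro h
    have := ENNReal.summable_toReal h.ne
    refine this.congr fun x => ?_
    rw [ENNReal.toReal_ofReal (h0 x)]
  · intro h
    exact h.tsum_ofReal_lt_top

omit [Countable X] in
include hp in
lemma ell_summable (u : G.ell p) : Summable fun x => |u x| ^ p.toReal * G.mu x :=
  (G.memLp_iff hp u).1 (Lp.memLp u)

include hp in
lemma exists_ell {φ : X → ℝ} (hφ : Summable fun x => |φ x| ^ p.toReal * G.mu x) :
    ∃ u : G.ell p, ∀ x, u x = φ x := by
  let _ : MeasurableSpace X := ⊤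
  exact ⟨((G.memLp_iff hp φ).2 hφ).toLp φ,
    (G.ae_nodeMeasure_iff _).1 ((G.memLp_iff hp φ).2 hφ).coeFn_toLp⟩

include hp in
lemma exists_ell_of_abs_le {φ : X → ℝ} (u : G.ell p) (hφ : ∀ x, |φ x| ≤ |u x|) :
    ∃ v : G.ell p, ∀ x, v x = φ x := by
  refine G.exists_ell hp (Summable.of_nonneg_of_le (fun x =>
    mul_nonneg (Real.rpow_nonneg (abs_nonneg _) _) (G.mu_pos x).le) (fun x => ?_)
    (G.ell_summable hp u))
  exact mul_le_mul_of_nonneg_right (Real.rpow_le_rpow (abs_nonneg _) (hφ x)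
    ENNReal.toReal_nonneg) (G.mu_pos x).le

include hp in
lemma ell_norm_rpow (u : G.ell p) : ‖u‖ ^ p.toReal = ∑' x, |u x| ^ p.toReal * G.mu x := by
  have hq := one_le_toReal hp
  rw [G.ell_norm p hp, ← Real.rpow_mul (tsum_nonneg fun x =>
    mul_nonneg (Real.rpow_nonneg (abs_nonneg _) _) (G.mu_pos x).le), one_div_mul_cancel (by linarith),
    Real.rpow_one]

include hp in
lemma ell_tendsto_of_dominated {un : ℕ → G.ell p} {u g : G.ell p}
    (hb : ∀ n x, |un n x| ≤ |g x|) (h : ∀ x, Tendsto (fun n => un n x) atTop (𝓝 (u x))) :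
    Tendsto un atTop (𝓝 u) := by
  have hq := one_le_toReal hp
  have hbu : ∀ x, |u x| ≤ |g x| := fun x => le_of_tendsto (h x).abs
    (Eventually.of_forall fun n => hb n x)
  have key : Tendsto (fun n => ∑' x, |(un n - u) x| ^ p.toReal * G.mu x) atTop
      (𝓝 (∑' _ : X, 0)) := by
    refine tendsto_tsum_of_dominated_convergence
      (bound := fun x => 2 ^ p.toReal * (|g x| ^ p.toReal * G.mu x))
      ((G.ell_summable hp g).mul_left _) (fun x => ?_) (Eventually.of_forall fun n x => ?_)
    · have h1 : Tendsto (fun n => |(un n - u) x| ^ p.toReal * G.mu x) atTop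
          (𝓝 (|u x - u x| ^ p.toReal * G.mu x)) := by
        simp_rw [ell_sub_apply]
        exact (((h x).sub_const _).abs.rpow_const (Or.inr (by linarith))).mul_const _
      simpa [Real.zero_rpow (by linarith : p.toReal ≠ 0)] using h1
    · have := G.mu_pos x
      rw [Real.norm_of_nonneg (by positivity), ← mul_assoc, ← Real.mul_rpow (by norm_num)
        (abs_nonneg _), ell_sub_apply]
      gcongr
      have h1 := abs_sub (un n x) (u x)
      linarith [hb n x, hbu x]
  rw [tsum_zero] at key
  rw [tendsto_iff_norm_sub_tendsto_zero]
  have h2 := key.rpow_const (p := 1 / p.toReal) (Or.inr (by positivity))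
  rw [Real.zero_rpow (by positivity)] at h2
  refine h2.congr fun n => ?_
  rw [G.ell_norm p hp]

open Classical in
include hp in
lemma exists_trunc (u : G.ell p) (S : Finset X) :
    ∃ v : G.ell p, ∀ x, v x = if x ∈ S then u x else 0 :=
  G.exists_ell_of_abs_le hp u fun x => by split_ifs <;> simp

open Classical in
include hp in
lemma tendsto_trunc {E : ℕ → Finset X} (hE : IsExhaustion E) {u : G.ell p} {un : ℕ → G.ell p}
    (hun : ∀ n x, un n x = if x ∈ E n then u x else 0) : Tendsto un atTop (𝓝 u) := by
  refine G.ell_tendsto_of_dominated hp (g := u) (fun n x => ?_) fun x => ?_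
  · rw [hun]
    split_ifs <;> simp
  · obtain ⟨m, hm⟩ := hE.2 x
    refine tendsto_const_nhds.congr' ?_
    filter_upwards [eventually_ge_atTop m] with n hn
    rw [hun, if_pos (hE.1 hn hm)]

end Ell

/-! ### Dirichlet operators on finite sets -/

section Operators

variable (G : WGraph X)

/-- The coefficient of the diagonal part of the Laplacian. -/
noncomputable def diag (x : X) : ℝ := ((∑' y, G.w x y) + G.kappa x) / G.mu x

lemma diag_nonneg (x : X) : 0 ≤ G.diag x :=
  div_nonneg (add_nonneg (tsum_nonneg (G.w_nonneg x)) (G.kappa_nonneg x)) (G.mu_pos x).le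

lemma opApprox_of_notMem (f : ℝ → ℝ) {S : Finset X} (u : X → ℝ) {x : X} (hx : x ∉ S) :
    G.opApprox f S u x = 0 := dif_neg hx

/-- The killing term collects the edges that leave `S`, so the diagonal is that of the whole graph
and only the neighbour sum is cut down to `S`. -/
lemma opApprox_of_mem {S : Finset X} (u : X → ℝ) {x : X} (hx : x ∈ S) :
    G.opApprox (fun r => -r) S u x
      = u x + G.diag x * u x - (1 / G.mu x) * ∑ y ∈ S, G.w x y * u y := by
  have h1 := (G.w_summable x).sum_add_tsum_subtype_compl S
  have h2 : ∑' y : S, G.w x y * (u x - u y) = ∑ y ∈ S, G.w x y * (u x - u y) := by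
    rw [tsum_fintype]
    exact Finset.sum_coe_sort S fun y => G.w x y * (u x - u y)
  rw [opApprox, dif_pos hx]
  simp only [lap, dirichlet, neg_neg, diag]
  rw [h2, ← h1]
  simp only [mul_sub, Finset.sum_sub_distrib, ← Finset.sum_mul]
  ring

lemma summable_of_domLap {u : X → ℝ} (hu : G.domLap u) (x : X) :
    Summable fun y => G.w x y * u y := by
  refine Summable.of_norm ((hu x).congr fun y => ?_)
  rw [norm_mul, Real.norm_of_nonneg (G.w_nonneg x y), Real.norm_eq_abs]

lemma lap_eq {u : X → ℝ} (hu : G.domLap u) (x : X) :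
    G.lap u x = G.diag x * u x - (1 / G.mu x) * ∑' y, G.w x y * u y := by
  simp only [lap, mul_sub, diag]
  rw [Summable.tsum_sub ((G.w_summable x).mul_right _) (G.summable_of_domLap hu x), tsum_mul_right]
  ring

lemma opApprox_add (S : Finset X) (u v : X → ℝ) (x : X) :
    G.opApprox (fun r => -r) S (fun y => u y + v y) x
      = G.opApprox (fun r => -r) S u x + G.opApprox (fun r => -r) S v x := by
  by_cases hx : x ∈ S
  · simp only [opApprox_of_mem _ _ hx, mul_add, Finset.sum_add_distrib]
    ring
  · simp [opApprox_of_notMem _ _ _ hx]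

lemma opApprox_smul (S : Finset X) (c : ℝ) (u : X → ℝ) (x : X) :
    G.opApprox (fun r => -r) S (fun y => c * u y) x = c * G.opApprox (fun r => -r) S u x := by
  by_cases hx : x ∈ S
  · simp only [opApprox_of_mem _ _ hx, mul_left_comm _ c, ← Finset.mul_sum]
    ring
  · simp [opApprox_of_notMem _ _ _ hx]

/-- The minimum principle for `1 + l 𝒜` on a finite set of nodes. -/
lemma nonneg_of_supersolution {S S' : Finset X} {l : ℝ} (hl : 0 < l) {u : X → ℝ}
    (hu : ∀ x ∈ S, 0 ≤ u x + l * (u x + G.diag x * u x - (1 / G.mu x) * ∑ y ∈ S', G.w x y * u y))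
    (hu' : ∀ x ∉ S, 0 ≤ u x) (x : X) : 0 ≤ u x := by
  by_contra! hx
  have hxS : x ∈ S := by
    by_contra h
    exact absurd (hu' x h) (not_le.2 hx)
  obtain ⟨z, hzS, hz⟩ := S.exists_min_image u ⟨x, hxS⟩
  have hz0 : u z < 0 := (hz x hxS).trans_lt hx
  have hmin : ∀ y, u z ≤ u y := fun y => by
    by_cases hy : y ∈ S
    · exact hz y hy
    · exact hz0.le.trans (hu' y hy)
  -- At a negative minimum, edges missing from `S'` only help, so `S'` may differ from `S`. This is
  -- what compares solutions on two sets of the exhaustion.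
  have h1 : (∑' y, G.w z y) * u z ≤ ∑ y ∈ S', G.w z y * u y := by
    calc (∑' y, G.w z y) * u z ≤ (∑ y ∈ S', G.w z y) * u z :=
          mul_le_mul_of_nonpos_right ((G.w_summable z).sum_le_tsum _ fun y _ => G.w_nonneg z y) hz0.le
      _ = ∑ y ∈ S', G.w z y * u z := Finset.sum_mul _ _ _
      _ ≤ _ := Finset.sum_le_sum fun y _ => mul_le_mul_of_nonneg_left (hmin y) (G.w_nonneg z y)
  have h2 := hu z hzS
  have hμ := G.mu_pos z
  have h3 : G.diag z * u z - (1 / G.mu z) * ∑ y ∈ S', G.w z y * u y ≤ 0 := by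
    have h4 : G.diag z * u z = (1 / G.mu z) * ((∑' y, G.w z y) * u z)
        + G.kappa z / G.mu z * u z := by
      rw [diag]; ring
    have h5 : G.kappa z / G.mu z * u z ≤ 0 :=
      mul_nonpos_of_nonneg_of_nonpos (div_nonneg (G.kappa_nonneg z) hμ.le) hz0.le
    have h6 := mul_le_mul_of_nonneg_left h1 (by positivity : 0 ≤ 1 / G.mu z)
    linarith
  have h7 : l * (u z + G.diag z * u z - (1 / G.mu z) * ∑ y ∈ S', G.w z y * u y) ≤ 0 :=
    mul_nonpos_of_nonneg_of_nonpos hl.le (by linarith)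
  linarith

/-- A square linear system: the minimum principle for `u` and `-u` gives injectivity, hence
surjectivity. -/
lemma exists_resolvent_approx (S : Finset X) {l : ℝ} (hl : 0 < l) (f : X → ℝ) :
    ∃ u : X → ℝ, (∀ x ∉ S, u x = 0) ∧
      ∀ x ∈ S, u x + l * G.opApprox (fun r => -r) S u x = f x := by
  classical
  let ext : (S → ℝ) → X → ℝ := fun u x => if hx : x ∈ S then u ⟨x, hx⟩ else 0
  have hext : ∀ u x, x ∉ S → ext u x = 0 := fun u x hx => dif_neg hx
  have hext' : ∀ u (x : S), ext u x = u x := fun u x => dif_pos x.2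
  have hadd : ∀ u v, ext (u + v) = fun x => ext u x + ext v x := fun u v => by
    funext x
    by_cases hx : x ∈ S <;> simp [ext, hx]
  have hsmul : ∀ (c : ℝ) u, ext (c • u) = fun x => c * ext u x := fun c u => by
    funext x
    by_cases hx : x ∈ S <;> simp [ext, hx]
  let L : (S → ℝ) →ₗ[ℝ] (S → ℝ) :=
    { toFun := fun u x => u x + l * G.opApprox (fun r => -r) S (ext u) x
      map_add' := fun u v => by
        funext x
        simp only [hadd, opApprox_add, Pi.add_apply]
        ring
      map_smul' := fun c u => by
        funext x
        simp only [hsmul, opApprox_smul, Pi.smul_apply, smul_eq_mul, RingHom.id_apply]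
        ring }
  have hnonneg : ∀ u, L u = 0 → ∀ x, 0 ≤ ext u x := fun u hu =>
    G.nonneg_of_supersolution (S := S) (S' := S) hl (fun x hx => by
      have := congrFun hu ⟨x, hx⟩
      have h : ext u x = u ⟨x, hx⟩ := hext' u ⟨x, hx⟩
      rw [← G.opApprox_of_mem _ hx, h]
      exact this.ge) fun x hx => (hext u x hx).ge
  have hinj : Function.Injective L := by
    rw [injective_iff_map_eq_zero]
    intro u hu
    funext x
    have h1 := hnonneg u hu x
    have h2 := hnonneg (-u) (by rw [map_neg, hu, neg_zero]) x
    rw [hext'] at h1 h2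
    simp only [Pi.neg_apply, Pi.zero_apply] at h2 ⊢
    linarith
  obtain ⟨u, hu⟩ := LinearMap.injective_iff_surjective.1 hinj fun x => f x
  refine ⟨ext u, hext u, fun x hx => ?_⟩
  have := congrFun hu ⟨x, hx⟩
  rw [← this]
  change ext u x + _ = u ⟨x, hx⟩ + _
  rw [hext' u ⟨x, hx⟩]

/-- The tangent to a convex power lies below it. -/
lemma rpow_tangent_le {q a b : ℝ} (hq : 1 ≤ q) (ha : 0 ≤ a) (hb : 0 ≤ b) :
    a ^ q + q * a ^ (q - 1) * (b - a) ≤ b ^ q := by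
  rcases ha.eq_or_lt with rfl | ha
  · rcases hq.eq_or_lt with rfl | hq
    · simp
    · rw [Real.zero_rpow (by linarith), Real.zero_rpow (by linarith)]
      simpa using Real.rpow_nonneg hb q
  · have h1 := one_add_mul_self_le_rpow_one_add (s := b / a - 1) (by
      have : 0 ≤ b / a := by positivity
      linarith) hq
    rw [add_sub_cancel, Real.div_rpow hb ha.le, le_div_iff₀ (by positivity)] at h1
    refine le_trans (le_of_eq ?_) h1
    rw [Real.rpow_sub_one ha.ne']
    field_simp

/-- The triangle inequality bounds `F x` below by `(1 + l)|u x|` plus a weighted sum of the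
differences `|u x| - |u y|`. After division by `1 + l`, the tangent inequality is used twice: at `|u
x|` against `F x / (1 + l)`, and to turn these differences into differences of powers, which cancel
upon summation. -/
lemma opApprox_accretive {q : ℝ} (hq : 1 ≤ q) (S : Finset X) {l : ℝ} (hl : 0 < l) (u : X → ℝ) :
    (1 + l) ^ q * ∑ x ∈ S, |u x| ^ q * G.mu x
      ≤ ∑ x ∈ S, |u x + l * G.opApprox (fun r => -r) S u x| ^ q * G.mu x := by
  set F : X → ℝ := fun x => |u x + l * G.opApprox (fun r => -r) S u x| with hF
  have hpt : ∀ x ∈ S, |u x| ^ q * G.mu x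
      + l / (1 + l) * ∑ y ∈ S, G.w x y * (|u x| ^ q - |u y| ^ q)
        ≤ (F x / (1 + l)) ^ q * G.mu x := by
    intro x hx
    have hμ := G.mu_pos x
    set a := |u x| with ha_def
    have ha : 0 ≤ a := abs_nonneg _
    have h1 : (1 + l) * a + l * (1 / G.mu x) * ∑ y ∈ S, G.w x y * (a - |u y|) ≤ F x := by
      have e : u x + l * G.opApprox (fun r => -r) S u x
          = (1 + l + l * G.diag x) * u x - l * (1 / G.mu x) * ∑ y ∈ S, G.w x y * u y := by
        rw [G.opApprox_of_mem u hx]; ring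
      have hd := G.diag_nonneg x
      have h2 : |∑ y ∈ S, G.w x y * u y| ≤ ∑ y ∈ S, G.w x y * |u y| := by
        refine (Finset.abs_sum_le_sum_abs _ _).trans_eq (Finset.sum_congr rfl fun y _ => ?_)
        rw [abs_mul, abs_of_nonneg (G.w_nonneg x y)]
      have h3 : (1 + l + l * G.diag x) * a - l * (1 / G.mu x) * ∑ y ∈ S, G.w x y * |u y| ≤ F x := by
        simp only [hF, e]
        refine le_trans ?_ (abs_sub_abs_le_abs_sub _ _)
        rw [abs_mul, abs_mul, abs_of_nonneg (by positivity : 0 ≤ 1 + l + l * G.diag x),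
          abs_of_nonneg (by positivity : 0 ≤ l * (1 / G.mu x))]
        exact sub_le_sub le_rfl (mul_le_mul_of_nonneg_left h2 (by positivity))
      have h4 : (∑ y ∈ S, G.w x y) * (1 / G.mu x) ≤ G.diag x := by
        rw [diag, div_eq_mul_one_div (_ + _)]
        refine mul_le_mul_of_nonneg_right ?_ (one_div_nonneg.2 hμ.le)
        have := (G.w_summable x).sum_le_tsum S fun y _ => G.w_nonneg x y
        linarith [G.kappa_nonneg x]
      refine le_trans ?_ h3
      simp only [mul_sub, Finset.sum_sub_distrib, ← Finset.sum_mul]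
      have := mul_le_mul_of_nonneg_left h4 (mul_nonneg hl.le ha)
      nlinarith
    have hl1 : 0 < 1 + l := by positivity
    have h5 : a + l / (1 + l) * (1 / G.mu x) * ∑ y ∈ S, G.w x y * (a - |u y|) ≤ F x / (1 + l) := by
      rw [le_div_iff₀ hl1]
      refine le_trans (le_of_eq ?_) h1
      field_simp
    have h6 := rpow_tangent_le hq ha (b := F x / (1 + l)) (by positivity)
    have h7 : q * a ^ (q - 1) * (l / (1 + l) * (1 / G.mu x) * ∑ y ∈ S, G.w x y * (a - |u y|))
        ≤ q * a ^ (q - 1) * (F x / (1 + l) - a) := by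
      gcongr
      linarith
    have h8 : l / (1 + l) * (1 / G.mu x) * ∑ y ∈ S, G.w x y * (a ^ q - |u y| ^ q)
        ≤ q * a ^ (q - 1) * (l / (1 + l) * (1 / G.mu x) * ∑ y ∈ S, G.w x y * (a - |u y|)) := by
      rw [mul_left_comm (q * a ^ (q - 1)), Finset.mul_sum S _ (q * a ^ (q - 1))]
      refine mul_le_mul_of_nonneg_left (Finset.sum_le_sum fun y _ => ?_) (by positivity)
      rw [mul_left_comm]
      refine mul_le_mul_of_nonneg_left ?_ (G.w_nonneg x y)
      linarith [rpow_tangent_le hq ha (abs_nonneg (u y))]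
    have h9 : a ^ q + l / (1 + l) * (1 / G.mu x) * ∑ y ∈ S, G.w x y * (a ^ q - |u y| ^ q)
        ≤ (F x / (1 + l)) ^ q := by linarith
    refine le_trans (le_of_eq ?_) (mul_le_mul_of_nonneg_right h9 hμ.le)
    field_simp
  -- The summand is antisymmetric in `x` and `y` because `w` is symmetric.
  have hanti : ∑ x ∈ S, ∑ y ∈ S, G.w x y * (|u x| ^ q - |u y| ^ q) = 0 := by
    simp only [mul_sub, Finset.sum_sub_distrib]
    rw [sub_eq_zero, Finset.sum_comm]
    refine Finset.sum_congr rfl fun x _ => Finset.sum_congr rfl fun y _ => ?_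
    rw [G.w_symm]
  have hsum := Finset.sum_le_sum hpt
  rw [Finset.sum_add_distrib, ← Finset.mul_sum, hanti, mul_zero, add_zero] at hsum
  have hl1 : 0 < 1 + l := by positivity
  calc _ ≤ (1 + l) ^ q * ∑ x ∈ S, (F x / (1 + l)) ^ q * G.mu x := by gcongr
    _ = _ := by
      rw [Finset.mul_sum]
      refine Finset.sum_congr rfl fun x _ => ?_
      rw [Real.div_rpow (abs_nonneg _) hl1.le]
      field_simp

end Operators

end WGraph

/-! ### The restriction to `Ω_p` is m-accretive -/

namespace WGraph

variable {X : Type*} [Countable X] (G : WGraph X) {p : ℝ≥0∞}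

omit [Countable X] in
lemma opA_apply {u v : G.ell p} (h : G.opA (fun r => -r) p u v) (x : X) :
    v x = u x + G.diag x * u x - (1 / G.mu x) * ∑' y, G.w x y * u y := by
  rw [h.2 x, G.lap_eq h.1, neg_neg, add_sub_assoc]

omit [Countable X] in
lemma opA_of_eq {u v : G.ell p} (hu : G.domLap u)
    (h : ∀ x, v x = u x + G.diag x * u x - (1 / G.mu x) * ∑' y, G.w x y * u y) :
    G.opA (fun r => -r) p u v :=
  ⟨hu, fun x => by rw [h, G.lap_eq hu, neg_neg, add_sub_assoc]⟩

lemma domLap_add {u v : G.ell p} (hu : G.domLap u) (hv : G.domLap v) : G.domLap (u + v : G.ell p) :=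
  fun x => Summable.of_nonneg_of_le (fun y => mul_nonneg (G.w_nonneg x y) (abs_nonneg _))
    (fun y => by
      rw [ell_add_apply, ← mul_add]
      exact mul_le_mul_of_nonneg_left (abs_add_le _ _) (G.w_nonneg x y)) ((hu x).add (hv x))

lemma domLap_smul (c : ℝ) {u : G.ell p} (hu : G.domLap u) : G.domLap (c • u : G.ell p) :=
  fun x => ((hu x).mul_left |c|).congr fun y => by
    rw [ell_smul_apply, abs_mul]; ring

lemma opA_add {u v u' v' : G.ell p} (h : G.opA (fun r => -r) p u v)
    (h' : G.opA (fun r => -r) p u' v') : G.opA (fun r => -r) p (u + u') (v + v') := by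
  refine G.opA_of_eq (G.domLap_add h.1 h'.1) fun x => ?_
  simp only [ell_add_apply, mul_add]
  rw [(G.summable_of_domLap h.1 x).tsum_add (G.summable_of_domLap h'.1 x), G.opA_apply h,
    G.opA_apply h']
  ring

lemma opA_smul (c : ℝ) {u v : G.ell p} (h : G.opA (fun r => -r) p u v) :
    G.opA (fun r => -r) p (c • u) (c • v) := by
  refine G.opA_of_eq (G.domLap_smul c h.1) fun x => ?_
  simp only [ell_smul_apply, mul_left_comm _ c]
  rw [tsum_mul_left, G.opA_apply h]
  ring

lemma opA_sub {u v u' v' : G.ell p} (h : G.opA (fun r => -r) p u v)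
    (h' : G.opA (fun r => -r) p u' v') : G.opA (fun r => -r) p (u - u') (v - v') := by
  simpa [sub_eq_add_neg] using G.opA_add h (G.opA_smul (-1) h')

variable [hp1 : Fact (1 ≤ p)] {E : ℕ → Finset X}

lemma opOmega_add {u v u' v' : G.ell p} (h : G.opOmega (fun r => -r) p E u v)
    (h' : G.opOmega (fun r => -r) p E u' v') :
    G.opOmega (fun r => -r) p E (u + u') (v + v') := by
  obtain ⟨h, un, an, h1, h2, h3, h4⟩ := h
  obtain ⟨h', un', an', h1', h2', h3', h4'⟩ := h'
  refine ⟨G.opA_add h h', fun n => un n + un' n, fun n => an n + an' n, fun n x hx => ?_,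
    fun n x => ?_, h3.add h3', h4.add h4'⟩
  · rw [ell_add_apply, h1 n x hx, h1' n x hx, add_zero]
  · rw [ell_add_apply, h2, h2', ← opApprox_add]
    congr 1
    funext y
    rw [ell_add_apply]

lemma opOmega_smul (c : ℝ) {u v : G.ell p} (h : G.opOmega (fun r => -r) p E u v) :
    G.opOmega (fun r => -r) p E (c • u) (c • v) := by
  obtain ⟨h, un, an, h1, h2, h3, h4⟩ := h
  refine ⟨G.opA_smul c h, fun n => c • un n, fun n => c • an n, fun n x hx => ?_,
    fun n x => ?_, h3.const_smul c, h4.const_smul c⟩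
  · rw [ell_smul_apply, h1 n x hx, mul_zero]
  · rw [ell_smul_apply, h2, ← opApprox_smul]
    congr 1
    funext y
    rw [ell_smul_apply]

variable (hp : p ≠ ∞)
include hp

lemma ell_norm_rpow_of_support {S : Finset X} (u : G.ell p) (hu : ∀ x ∉ S, u x = 0) :
    ‖u‖ ^ p.toReal = ∑ x ∈ S, |u x| ^ p.toReal * G.mu x := by
  have hq := one_le_toReal hp
  rw [G.ell_norm_rpow hp]
  refine tsum_eq_sum fun x hx => ?_
  rw [hu x hx, abs_zero, Real.zero_rpow (by linarith), zero_mul]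

lemma norm_le_of_opApprox {S : Finset X} {l : ℝ} (hl : 0 < l) {u a : G.ell p}
    (hu : ∀ x ∉ S, u x = 0) (ha : ∀ x, a x = G.opApprox (fun r => -r) S u x) :
    (1 + l) * ‖u‖ ≤ ‖u + l • a‖ := by
  have hq := one_le_toReal hp
  have hq0 : 0 < p.toReal := by linarith
  refine (Real.rpow_le_rpow_iff (by positivity) (norm_nonneg _) hq0).1 ?_
  rw [Real.mul_rpow (by positivity) (norm_nonneg _), G.ell_norm_rpow_of_support hp u hu,
    G.ell_norm_rpow_of_support hp (S := S) (u + l • a) fun x hx => by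
      rw [ell_add_apply, ell_smul_apply, hu x hx, ha, G.opApprox_of_notMem _ _ hx]; simp]
  refine (G.opApprox_accretive hq S hl u).trans_eq (Finset.sum_congr rfl fun x _ => ?_)
  rw [ell_add_apply, ell_smul_apply, ha]

lemma opOmega_accretive {u v : G.ell p} (h : G.opOmega (fun r => -r) p E u v) {l : ℝ}
    (hl : 0 < l) : (1 + l) * ‖u‖ ≤ ‖u + l • v‖ := by
  obtain ⟨-, un, an, h1, h2, h3, h4⟩ := h
  exact le_of_tendsto_of_tendsto' (h3.norm.const_mul _) (h3.add (h4.const_smul l)).norm fun n =>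
    G.norm_le_of_opApprox hp hl (h1 n) (h2 n)

variable (hE : IsExhaustion E)
include hE

/-- Monotone convergence of the Dirichlet resolvents `U n`. Their images under the approximating
operators are `l⁻¹ • (fn n - un n)`, so convergence of `un` in `ℓ^p` already yields the convergence
that `Ω_p` demands. -/
lemma opOmega_range_of_nonneg {l : ℝ} (hl : 0 < l) {f : G.ell p} (hf : ∀ x, 0 ≤ f x) :
    ∃ u v, G.opOmega (fun r => -r) p E u v ∧ u + l • v = f := by
  classical
  have hq := one_le_toReal hp
  have hq0 : 0 < p.toReal := by linarith
  choose U hU0 hU using fun n => G.exists_resolvent_approx (E n) hl f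
  have hUpos : ∀ n x, 0 ≤ U n x := fun n =>
    G.nonneg_of_supersolution (S := E n) (S' := E n) hl (fun x hx => by
      rw [← G.opApprox_of_mem _ hx, hU n x hx]; exact hf x) fun x hx => (hU0 n x hx).ge
  -- On `E n` the difference solves the homogeneous equation with neighbour sum over `E (n + 1)`;
  -- off `E n` it equals `U (n + 1) ≥ 0`.
  have hUmono : ∀ x, Monotone fun n => U n x := fun x => monotone_nat_of_le_succ fun n => by
    have := G.nonneg_of_supersolution (S := E n) (S' := E (n + 1)) hl
      (u := fun x => U (n + 1) x - U n x) (fun x hx => ?_) (fun x hx => ?_) x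
    · exact sub_nonneg.1 this
    · have e1 := hU (n + 1) x (hE.1 n.le_succ hx)
      have e2 := hU n x hx
      rw [G.opApprox_of_mem _ (hE.1 n.le_succ hx)] at e1
      rw [G.opApprox_of_mem _ hx, Finset.sum_subset (hE.1 n.le_succ) fun y _ hy => by
        rw [hU0 n y hy, mul_zero]] at e2
      simp only [mul_sub, Finset.sum_sub_distrib] at e1 e2 ⊢
      linarith
    · rw [hU0 n x hx, sub_zero]
      exact hUpos _ _
  choose fn hfn using fun n => G.exists_trunc hp f (E n)
  have hfnt : Tendsto fn atTop (𝓝 f) := G.tendsto_trunc hp hE hfn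
  have hsumm : ∀ n, Summable fun x => |U n x| ^ p.toReal * G.mu x := fun n =>
    summable_of_ne_finset_zero (s := E n) fun x hx => by
      rw [hU0 n x hx, abs_zero, Real.zero_rpow hq0.ne', zero_mul]
  choose un hun using fun n => G.exists_ell hp (hsumm n)
  obtain ⟨an, han⟩ : ∃ an : ℕ → G.ell p, ∀ n, an n = l⁻¹ • (fn n - un n) := ⟨_, fun n => rfl⟩
  have hunU : ∀ n, (un n : X → ℝ) = U n := fun n => funext (hun n)
  have hun0 : ∀ n, ∀ x ∉ E n, un n x = 0 := fun n x hx => by rw [hun, hU0 n x hx]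
  have hanA : ∀ n x, an n x = G.opApprox (fun r => -r) (E n) (un n) x := fun n x => by
    rw [han, ell_smul_apply, ell_sub_apply, hfn, hunU]
    by_cases hx : x ∈ E n
    · rw [if_pos hx, ← hU n x hx, add_sub_cancel_left, inv_mul_cancel_left₀ hl.ne']
    · rw [if_neg hx, hU0 n x hx, G.opApprox_of_notMem _ _ hx, sub_zero, mul_zero]
  have hnorm : ∀ n, ‖un n‖ ≤ ‖f‖ := fun n => by
    have h1 := G.norm_le_of_opApprox hp hl (hun0 n) (hanA n)
    rw [han, smul_inv_smul₀ hl.ne', add_sub_cancel] at h1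
    have h2 : ‖fn n‖ ≤ ‖f‖ := by
      refine (Real.rpow_le_rpow_iff (norm_nonneg _) (norm_nonneg _) hq0).1 ?_
      rw [G.ell_norm_rpow hp, G.ell_norm_rpow hp]
      refine (G.ell_summable hp _).tsum_le_tsum (fun x => ?_) (G.ell_summable hp _)
      refine mul_le_mul_of_nonneg_right (Real.rpow_le_rpow (abs_nonneg _) ?_ hq0.le)
        (G.mu_pos x).le
      rw [hfn]
      split_ifs <;> simp
    have h3 : ‖un n‖ ≤ (1 + l) * ‖un n‖ := le_mul_of_one_le_left (norm_nonneg _) (by linarith)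
    linarith
  have hfin : ∀ n (F : Finset X), ∑ x ∈ F, U n x ^ p.toReal * G.mu x ≤ ‖f‖ ^ p.toReal :=
    fun n F => by
    have h1 := (G.ell_summable hp (un n)).sum_le_tsum F fun x _ =>
      mul_nonneg (Real.rpow_nonneg (abs_nonneg _) _) (G.mu_pos x).le
    rw [← G.ell_norm_rpow hp, hunU] at h1
    simp only [abs_of_nonneg (hUpos n _)] at h1
    exact h1.trans (Real.rpow_le_rpow (norm_nonneg _) (hnorm n) hq0.le)
  have hlim : ∀ x, ∃ a, Tendsto (fun n => U n x) atTop (𝓝 a) := fun x => by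
    refine ⟨_, tendsto_atTop_ciSup (hUmono x) ⟨(‖f‖ ^ p.toReal / G.mu x) ^ (1 / p.toReal), ?_⟩⟩
    rintro _ ⟨n, rfl⟩
    have h1 := hfin n {x}
    rw [Finset.sum_singleton, ← le_div_iff₀ (G.mu_pos x)] at h1
    rw [one_div, Real.le_rpow_inv_iff_of_pos (hUpos n x)
      (div_nonneg (Real.rpow_nonneg (norm_nonneg _) _) (G.mu_pos x).le) hq0]
    exact h1
  choose u hu using hlim
  have hle : ∀ n x, U n x ≤ u x := fun n x => (hUmono x).ge_of_tendsto (hu x) n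
  have hupos : ∀ x, 0 ≤ u x := fun x => (hUpos 0 x).trans (hle 0 x)
  obtain ⟨ul, hul⟩ : ∃ v : G.ell p, ∀ x, v x = u x := G.exists_ell hp (by
    simp only [abs_of_nonneg (hupos _)]
    refine summable_of_sum_le (c := ‖f‖ ^ p.toReal) (fun x =>
      mul_nonneg (Real.rpow_nonneg (hupos x) _) (G.mu_pos x).le) fun F => ?_
    refine le_of_tendsto' (tendsto_finsetSum F fun x _ =>
      ((hu x).rpow_const (Or.inr hq0.le)).mul_const _) fun n => hfin n F)
  have hunt : Tendsto un atTop (𝓝 ul) := by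
    refine G.ell_tendsto_of_dominated hp (g := ul) (fun n x => ?_) fun x => ?_
    · rw [hun, hul, abs_of_nonneg (hUpos n x), abs_of_nonneg (hupos x)]
      exact hle n x
    · simp only [hun, hul]
      exact hu x
  have heq : ∀ n, ∀ x ∈ E n, ∑ y ∈ E n, G.w x y * U n y
      = G.mu x / l * (U n x + l * (U n x + G.diag x * U n x) - f x) := fun n x hx => by
    have h1 := hU n x hx
    rw [G.opApprox_of_mem _ hx] at h1
    have := G.mu_pos x
    rw [← h1]
    field_simp
    ring
  -- Membership in `dom(Δ)` comes from the equation itself: it expresses the neighbour sum through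
  -- values at `x`, and these converge.
  have hsummu : ∀ x, Summable fun y => G.w x y * u y := fun x => by
    obtain ⟨m, hm⟩ := hE.2 x
    refine summable_of_sum_le
      (c := G.mu x / l * (u x + l * (u x + G.diag x * u x) - f x))
      (fun y => mul_nonneg (G.w_nonneg x y) (hupos y)) fun F => ?_
    refine le_of_tendsto_of_tendsto (tendsto_finsetSum F fun y _ => (hu y).const_mul _)
      (((hu x).add (((hu x).add ((hu x).const_mul (G.diag x))).const_mul l)).sub_const
        (f x) |>.const_mul _) ?_
    filter_upwards [eventually_ge_atTop m] with n hn
    rw [← heq n x (hE.1 hn hm)]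
    have h2 : ∑ y ∈ F, G.w x y * U n y ≤ ∑ y ∈ F ∪ E n, G.w x y * U n y :=
      Finset.sum_le_sum_of_subset_of_nonneg Finset.subset_union_left fun y _ _ =>
        mul_nonneg (G.w_nonneg x y) (hUpos n y)
    refine h2.trans_eq (Finset.sum_subset Finset.subset_union_right fun y _ hy => ?_).symm
    rw [hU0 n y hy, mul_zero]
  have hlimeq : ∀ x, ∑' y, G.w x y * u y
      = G.mu x / l * (u x + l * (u x + G.diag x * u x) - f x) := fun x => by
    obtain ⟨m, hm⟩ := hE.2 x
    have h1 : Tendsto (fun n => ∑' y, G.w x y * U n y) atTop (𝓝 (∑' y, G.w x y * u y)) := by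
      refine tendsto_tsum_of_dominated_convergence (hsummu x) (fun y => (hu y).const_mul _)
        (Eventually.of_forall fun n y => ?_)
      rw [Real.norm_of_nonneg (mul_nonneg (G.w_nonneg x y) (hUpos n y))]
      exact mul_le_mul_of_nonneg_left (hle n y) (G.w_nonneg x y)
    refine tendsto_nhds_unique h1 ?_
    refine ((((hu x).add (((hu x).add ((hu x).const_mul (G.diag x))).const_mul l)).sub_const
        (f x)).const_mul _).congr' ?_
    filter_upwards [eventually_ge_atTop m] with n hn
    rw [← heq n x (hE.1 hn hm)]
    refine (tsum_eq_sum fun y hy => ?_).symm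
    rw [hU0 n y hy, mul_zero]
  have hulu : (ul : X → ℝ) = u := funext hul
  refine ⟨ul, l⁻¹ • (f - ul), ⟨G.opA_of_eq (fun x => ?_) fun x => ?_, un, an, hun0, hanA, hunt, ?_⟩,
    ?_⟩
  · simp only [hulu, abs_of_nonneg (hupos _)]
    exact hsummu x
  · have := G.mu_pos x
    rw [ell_smul_apply, ell_sub_apply, hulu, hlimeq]
    field_simp
    ring
  · rw [funext han]
    exact (hfnt.sub hunt).const_smul _
  · rw [smul_inv_smul₀ hl.ne', add_sub_cancel]

lemma opOmega_range {l : ℝ} (hl : 0 < l) (f : G.ell p) :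
    ∃ u v, G.opOmega (fun r => -r) p E u v ∧ u + l • v = f := by
  have aux : ∀ a : ℝ, |max a 0| ≤ |a| := fun a => by
    rw [abs_of_nonneg (le_max_right _ _)]
    exact max_le (le_abs_self a) (abs_nonneg a)
  obtain ⟨f₁, h₁⟩ := G.exists_ell_of_abs_le hp f fun x => aux (f x)
  obtain ⟨f₂, h₂⟩ := G.exists_ell_of_abs_le hp f fun x => (aux (-f x)).trans_eq (abs_neg _)
  obtain ⟨u₁, v₁, hA₁, e₁⟩ := G.opOmega_range_of_nonneg hp hE hl (f := f₁) fun x => by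
    rw [h₁]; exact le_max_right _ _
  obtain ⟨u₂, v₂, hA₂, e₂⟩ := G.opOmega_range_of_nonneg hp hE hl (f := f₂) fun x => by
    rw [h₂]; exact le_max_right _ _
  refine ⟨_, _, G.opOmega_add hA₁ (G.opOmega_smul (-1) hA₂), ?_⟩
  have e : f = f₁ - f₂ := G.ell_ext p _ _ fun x => by
    rw [ell_sub_apply, h₁, h₂]
    rcases le_total 0 (f x) with h | h
    · rw [max_eq_left h, max_eq_right (by linarith)]; ring
    · rw [max_eq_right h, max_eq_left (by linarith)]; ring
  rw [e, ← e₁, ← e₂, neg_one_smul, neg_one_smul, smul_add, smul_neg]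
  abel

variable (hC : 1 < p → G.CondC p)
include hC

-- Off the diagonal, the image of the indicator of `z` is `-w(x, z) / μ(x)`, and `CondC` says that
-- this is in `ℓ^p`; for `p = 1` summability of `w z` suffices.
open Classical in
lemma exists_opOmega_single (z : X) {d : G.ell p} (hd : ∀ x, d x = if x = z then 1 else 0) :
    ∃ v, G.opOmega (fun r => -r) p E d v := by
  have hq := one_le_toReal hp
  have hw : Summable fun x => |G.w x z / G.mu x| ^ p.toReal * G.mu x := by
    have e : ∀ x, |G.w x z / G.mu x| ^ p.toReal * G.mu x
        = G.w z x ^ p.toReal / G.mu x ^ (p.toReal - 1) := fun x => by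
      have := G.mu_pos x
      rw [abs_of_nonneg (div_nonneg (G.w_nonneg x z) this.le), Real.div_rpow (G.w_nonneg x z) this.le,
        Real.rpow_sub_one this.ne', G.w_symm]
      field_simp
    simp only [e]
    rcases hp1.out.eq_or_lt with h | h
    · subst h
      simpa using G.w_summable z
    · exact hC h z
  obtain ⟨a, ha⟩ := G.exists_ell hp hw
  have hsum : ∀ x, HasSum (fun y => G.w x y * d y) (G.w x z) := fun x => by
    convert hasSum_ite_eq z (G.w x z) using 2 with y
    rw [hd]
    split_ifs with h <;> simp [h]
  have hdom : G.domLap d := fun x => (hsum x).summable.congr fun y => by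
    rw [hd]
    split_ifs <;> simp
  set v : G.ell p := (1 + G.diag z) • d - a with hv
  have hvx : ∀ x, v x = d x + G.diag x * d x - (1 / G.mu x) * G.w x z := fun x => by
    rw [hv, ell_sub_apply, ell_smul_apply, ha, hd]
    split_ifs with h
    · subst h; ring
    · ring
  obtain ⟨m, hm⟩ := hE.2 z
  choose dn hdn using fun n => G.exists_trunc hp d (E n)
  choose vn hvn using fun n => G.exists_trunc hp v (E n)
  -- As long as `z ∉ E n`, the truncated indicator vanishes and so must its image.
  obtain ⟨an, han⟩ : ∃ an : ℕ → G.ell p, ∀ n, an n = if z ∈ E n then vn n else 0 :=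
    ⟨_, fun n => rfl⟩
  refine ⟨v, G.opA_of_eq hdom fun x => ?_, dn, an,
    fun n x hx => ?_, fun n x => ?_, G.tendsto_trunc hp hE hdn, ?_⟩
  · rw [hvx, (hsum x).tsum_eq]
  · rw [hdn, if_neg hx]
  · rw [han]
    by_cases hx : x ∈ E n
    · rw [G.opApprox_of_mem _ hx]
      have e : ∑ y ∈ E n, G.w x y * dn n y = if z ∈ E n then G.w x z else 0 := by
        rw [← Finset.sum_ite_eq' (E n) z fun y => G.w x y]
        refine Finset.sum_congr rfl fun y hy => ?_
        rw [hdn, if_pos hy, hd]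
        split_ifs <;> simp
      rw [e, hdn, if_pos hx]
      split_ifs with hz
      · rw [hvn, if_pos hx, hvx]
      · rw [ell_zero_apply, hd, if_neg (fun h : x = z => hz (h ▸ hx))]
        simp
    · rw [G.opApprox_of_notMem _ _ hx]
      split_ifs
      · rw [hvn, if_neg hx]
      · exact G.ell_zero_apply x
  · refine (G.tendsto_trunc hp hE hvn).congr' ?_
    filter_upwards [eventually_ge_atTop m] with n hn
    rw [han, if_pos (hE.1 hn hm)]

lemma dense_opOmega : Dense {u | ∃ v, G.opOmega (fun r => -r) p E u v} := by
  classical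
  have hq := one_le_toReal hp
  have hfin : ∀ (u : G.ell p) (S : Finset X) (w : G.ell p), (∀ x, w x = if x ∈ S then u x else 0) →
      ∃ v, G.opOmega (fun r => -r) p E w v := by
    intro u S
    induction S using Finset.induction_on with
    | empty =>
      intro w hw
      obtain ⟨u', v', h, -⟩ := G.opOmega_range hp hE one_pos u
      have e : w = (0 : ℝ) • u' := G.ell_ext p _ _ fun x => by
        rw [hw, ell_smul_apply]; simp
      exact ⟨_, e ▸ G.opOmega_smul 0 h⟩
    | insert z S hz ih =>
      intro w hw
      obtain ⟨w', hw'⟩ := G.exists_trunc hp u S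
      obtain ⟨v', h'⟩ := ih w' hw'
      obtain ⟨d, hd⟩ := G.exists_ell hp (φ := fun x => if x = z then 1 else 0)
        (summable_of_ne_finset_zero (s := {z}) fun x hx => by
          rw [if_neg (by simpa using hx), abs_zero, Real.zero_rpow (by linarith), zero_mul])
      obtain ⟨v, h⟩ := G.exists_opOmega_single hp hE hC z hd
      have e : w = w' + u z • d := G.ell_ext p _ _ fun x => by
        rw [hw, ell_add_apply, ell_smul_apply, hw', hd]
        by_cases hxz : x = z
        · subst hxz; simp [hz]
        · simp [hxz]
      exact ⟨_, e ▸ G.opOmega_add h' (G.opOmega_smul (u z) h)⟩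
  intro u
  choose un hun using fun n => G.exists_trunc hp u (E n)
  exact mem_closure_of_tendsto (G.tendsto_trunc hp hE hun)
    (Eventually.of_forall fun n => hfin u (E n) (un n) (hun n))

theorem isMAccretive_opOmega : IsMAccretive (G.opOmega (fun r => -r) p E) where
  add := G.opOmega_add
  smul c := G.opOmega_smul c
  accretive h _ hl := G.opOmega_accretive hp h hl
  range hl f := G.opOmega_range hp hE hl f
  dense := G.dense_opOmega hp hE hC

end WGraph

/-! ### The maximal domain under (IP) or (B) -/

namespace WGraph

variable {X : Type*} [Countable X] (G : WGraph X) {p : ℝ≥0∞}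

/-- Kernel elements of `1 + 𝒜` have subsolutions as absolute values. The factor `2` counts the
identity in `1 + 𝒜` and the one inside `𝒜`. -/
lemma abs_subsolution {u v : G.ell p} (h : G.opA (fun r => -r) p u v) (h0 : u + v = 0) (x : X) :
    (2 * G.mu x + ∑' y, G.w x y) * |u x| ≤ ∑' y, G.w x y * |u y| := by
  have hμ := G.mu_pos x
  have h1 : (2 * G.mu x + (∑' y, G.w x y) + G.kappa x) * u x = ∑' y, G.w x y * u y := by
    have h2 := ell_add_apply G u v x
    rw [h0, ell_zero_apply, G.opA_apply h, diag] at h2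
    field_simp at h2
    linarith
  have hD : 0 ≤ ∑' y, G.w x y := tsum_nonneg (G.w_nonneg x)
  calc _ ≤ (2 * G.mu x + (∑' y, G.w x y) + G.kappa x) * |u x| := by
        exact mul_le_mul_of_nonneg_right (by linarith [G.kappa_nonneg x]) (abs_nonneg _)
    _ = |∑' y, G.w x y * u y| := by
        rw [← h1, abs_mul, abs_of_nonneg (by linarith [G.kappa_nonneg x] :
          0 ≤ 2 * G.mu x + (∑' y, G.w x y) + G.kappa x)]
    _ ≤ ∑' y, |G.w x y * u y| := by
        have := norm_tsum_le_tsum_norm (G.summable_of_domLap h.1 x).norm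
        simpa only [Real.norm_eq_abs] using this
    _ = _ := by simp only [abs_mul, abs_of_nonneg (G.w_nonneg x _)]

omit [Countable X] in
/-- Under bounded edge degree, nonnegative summable subsolutions vanish. -/
lemma tsum_nonpos_of_subsolution (hB : G.CondB) {V : X → ℝ} (hV0 : ∀ x, 0 ≤ V x)
    (hVs : Summable fun x => V x * G.mu x) {c : ℝ}
    (hV : (∀ x, Summable fun y => G.w x y * V y) →
      ∀ x, (∑' y, G.w x y) * V x + c * (V x * G.mu x) ≤ ∑' y, G.w x y * V y) :
    c * ∑' x, V x * G.mu x ≤ 0 := by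
  obtain ⟨C, hC⟩ := hB
  have hC' : ∀ x, ∑' y, G.w x y ≤ C * G.mu x := fun x => (div_le_iff₀ (G.mu_pos x)).1 (hC x)
  have hDV : Summable fun x => (∑' y, G.w x y) * V x := by
    refine Summable.of_nonneg_of_le (fun x => mul_nonneg (tsum_nonneg (G.w_nonneg x)) (hV0 x))
      (fun x => ?_) (hVs.mul_left C)
    calc _ ≤ C * G.mu x * V x := mul_le_mul_of_nonneg_right (hC' x) (hV0 x)
      _ = _ := by ring
  -- Bounded degree makes the double sum absolutely convergent. Exchanging the order of summation
  -- and using symmetry then cancels the Laplacian part, and the summability that `hV` takes as a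
  -- premise becomes available.
  have hprod : Summable fun z : X × X => G.w z.1 z.2 * V z.1 := by
    have hrow : ∀ x, Summable fun y => G.w x y * V x := fun x => (G.w_summable x).mul_right (V x)
    have hnn : ∀ z : X × X, 0 ≤ G.w z.1 z.2 * V z.1 := fun z =>
      mul_nonneg (G.w_nonneg z.1 z.2) (hV0 z.1)
    refine (summable_prod_of_nonneg hnn).2 ⟨hrow, ?_⟩
    simpa only [tsum_mul_right] using hDV
  have hprod' : Summable (Function.uncurry fun x y => G.w x y * V y) := by
    refine ((Equiv.prodComm X X).summable_iff.2 hprod).congr fun z => ?_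
    simp [Function.uncurry, G.w_symm z.1 z.2]
  have hcomm : ∑' x, ∑' y, G.w x y * V y = ∑' x, (∑' y, G.w x y) * V x := by
    refine hprod'.tsum_comm.symm.trans (tsum_congr fun y => ?_)
    rw [tsum_mul_right]
    simp only [G.w_symm y]
  have hpt := hV fun x => hprod'.prod_factor x
  have hsum := (hDV.add (hVs.mul_left c)).tsum_le_tsum hpt hprod'.prod
  rw [hDV.tsum_add (hVs.mul_left _), hcomm, tsum_mul_left] at hsum
  linarith

variable [hp1 : Fact (1 ≤ p)] (hp : p ≠ ∞)
include hp

/-- A weighted mean of `|u|` over neighbours exceeds `|u x|` wherever `u x ≠ 0`, so some neighbour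
has a strictly larger value. Iterating gives a path that never repeats and on which `|u| ≥ |u x₀|`;
since `u ∈ ℓ^p`, its measure is finite. -/
lemma eq_zero_of_condIP (hIP : G.CondIP) {u v : G.ell p} (h : G.opA (fun r => -r) p u v)
    (h0 : u + v = 0) : u = 0 := by
  have hq := one_le_toReal hp
  by_contra hne
  obtain ⟨x₀, hx₀⟩ : ∃ x, u x ≠ 0 := by
    by_contra! hall
    exact hne (G.ell_ext p _ _ fun x => by rw [hall, ell_zero_apply])
  have hstep : ∀ x : {x // u x ≠ 0}, ∃ y : {x // u x ≠ 0}, G.w x y ≠ 0 ∧ |u x| < |u y| := by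
    rintro ⟨x, hx⟩
    by_contra! hcon
    have hxpos : 0 < |u x| := abs_pos.2 hx
    have h1 : ∀ y, G.w x y * |u y| ≤ G.w x y * |u x| := fun y => by
      by_cases hw : G.w x y = 0
      · simp [hw]
      by_cases hy : u y = 0
      · rw [hy, abs_zero, mul_zero]
        exact mul_nonneg (G.w_nonneg x y) hxpos.le
      · exact mul_le_mul_of_nonneg_left (hcon ⟨y, hy⟩ hw) (G.w_nonneg x y)
    have h2 := (h.1 x).tsum_le_tsum h1 ((G.w_summable x).mul_right _)
    rw [tsum_mul_right] at h2
    have h3 := G.abs_subsolution h h0 x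
    have := mul_pos (G.mu_pos x) hxpos
    linarith
  choose s hsw hsu using hstep
  let γ : ℕ → {x // u x ≠ 0} := fun n => s^[n] ⟨x₀, hx₀⟩
  have hγ : ∀ n, γ (n + 1) = s (γ n) := fun n => Function.iterate_succ_apply' s n _
  have hmono : StrictMono fun n => |u (γ n)| := strictMono_nat_of_lt_succ fun n => by
    rw [hγ]; exact hsu _
  have hinj : Function.Injective fun n => (γ n : X) := fun m n hmn =>
    hmono.injective (by simp only at hmn ⊢; rw [hmn])
  refine hIP (fun n => γ n) hinj (fun n => by rw [hγ]; exact hsw _) ?_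
  have hpos : 0 < |u x₀| ^ p.toReal := Real.rpow_pos_of_pos (abs_pos.2 hx₀) _
  refine Summable.of_nonneg_of_le (fun n => (G.mu_pos _).le) (fun n => ?_)
    (((G.ell_summable hp u).comp_injective hinj).mul_left (|u x₀| ^ p.toReal)⁻¹)
  rw [← div_eq_inv_mul, le_div_iff₀ hpos, mul_comm]
  refine mul_le_mul_of_nonneg_right (Real.rpow_le_rpow (abs_nonneg _) ?_ (by linarith))
    (G.mu_pos _).le
  exact hmono.monotone (Nat.zero_le n)

/-- By convexity `|u| ^ p` is again a subsolution, now summable against `μ`, and the zeroth-order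
constant `2` becomes `2p`. Summing over all nodes leaves `2p‖u‖ ^ p ≤ 0`. -/
lemma eq_zero_of_condB (hB : G.CondB) {u v : G.ell p} (h : G.opA (fun r => -r) p u v)
    (h0 : u + v = 0) : u = 0 := by
  have hq := one_le_toReal hp
  obtain ⟨V, hV⟩ : ∃ V : X → ℝ, ∀ x, V x = |u x| ^ p.toReal := ⟨_, fun x => rfl⟩
  have hVs : Summable fun x => V x * G.mu x := by simpa only [hV] using G.ell_summable hp u
  have h6 := G.tsum_nonpos_of_subsolution hB (c := 2 * p.toReal)
    (fun x => (hV x).ge.trans' (Real.rpow_nonneg (abs_nonneg _) _)) hVs (fun hsx x => ?_)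
  · simp only [hV] at h6
    rw [← G.ell_norm_rpow hp u] at h6
    by_contra hne
    have := Real.rpow_pos_of_pos (norm_pos_iff.2 hne) p.toReal
    nlinarith
  · set b := p.toReal * |u x| ^ (p.toReal - 1) with hb
    have hb0 : 0 ≤ b := mul_nonneg (by linarith) (Real.rpow_nonneg (abs_nonneg _) _)
    have h1 : ∀ y, G.w x y * (V x - b * |u x|) + b * (G.w x y * |u y|) ≤ G.w x y * V y := fun y => by
      have := mul_le_mul_of_nonneg_left (rpow_tangent_le hq (abs_nonneg (u x)) (abs_nonneg (u y)))
        (G.w_nonneg x y)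
      rw [← hV, ← hV, ← hb] at this
      linarith
    have h2 := (((G.w_summable x).mul_right (V x - b * |u x|)).add
      ((h.1 x).mul_left b)).tsum_le_tsum h1 (hsx x)
    rw [((G.w_summable x).mul_right (V x - b * |u x|)).tsum_add ((h.1 x).mul_left b),
      tsum_mul_right, tsum_mul_left] at h2
    have h3 := mul_le_mul_of_nonneg_left (G.abs_subsolution h h0 x) hb0
    have h4 : b * |u x| = p.toReal * V x := by
      rw [hb, hV, mul_assoc]
      congr 1
      rcases (abs_nonneg (u x)).eq_or_lt with hz | hz
      · simp only [← hz, mul_zero]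
        rw [Real.zero_rpow (by linarith)]
      · simp only [Real.rpow_sub_one hz.ne']
        field_simp
    have h5 : b * ((2 * G.mu x + ∑' y, G.w x y) * |u x|)
        = (2 * G.mu x + ∑' y, G.w x y) * (p.toReal * V x) := by
      rw [← h4]; ring
    rw [h5] at h3
    rw [h4] at h2
    linarith

/-- A surjective operator has no proper injective extension. -/
lemma opOmega_of_opA {E : ℕ → Finset X} (hE : IsExhaustion E) (hIB : G.CondIP ∨ G.CondB)
    {u v : G.ell p} (h : G.opA (fun r => -r) p u v) : G.opOmega (fun r => -r) p E u v := by
  obtain ⟨u', v', h', e⟩ := G.opOmega_range hp hE one_pos (u + v)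
  rw [one_smul] at e
  have hs := G.opA_sub h h'.1
  have e0 : u - u' + (v - v') = 0 := by rw [sub_add_sub_comm, e, sub_self]
  have e1 : u - u' = 0 := hIB.elim (fun hI => G.eq_zero_of_condIP hp hI hs e0)
    fun hB => G.eq_zero_of_condB hp hB hs e0
  rw [e1, zero_add, sub_eq_zero] at e0
  rw [sub_eq_zero] at e1
  rwa [e1, e0]

end WGraph

theorem proposition6p2 {X : Type*} [Countable X] (G : WGraph X)
    (p : ℝ≥0∞) [Fact (1 ≤ p)] (hp : p ≠ ∞) (hC : 1 < p → G.CondC p)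
    (E : ℕ → Finset X) (hE : WGraph.IsExhaustion E) :
    ∃ S : ℝ → G.ell p →L[ℝ] G.ell p,
      IsExpNeg (G.opOmega (fun r => -r) p E) S ∧
      ∀ (T : ℝ≥0∞), 0 < T → ∀ (u₀ : G.ell p) (h : ℝ → G.ell p),
        LocallyIntegrableOn h (timeInterval T) →
        ∃ u : ℝ → G.ell p,
          -- existence and uniqueness
          IsMild (G.opOmega (fun r => -r) p E) h u₀ T u ∧
          (∀ v, IsMild (G.opOmega (fun r => -r) p E) h u₀ T v → EqOn v u (timeInterval T)) ∧
          -- the Duhamel formula and the norm estimate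
          (∀ t ∈ timeInterval T,
            IntervalIntegrable (fun s => S (t - s) (h s)) volume 0 t ∧
            u t = S t u₀ + ∫ s in (0 : ℝ)..t, S (t - s) (h s)) ∧
          (∀ t ∈ timeInterval T,
            ‖u t‖ ≤ Real.exp (-t) * ‖u₀‖
              + ∫ s in (0 : ℝ)..t, Real.exp (-(t - s)) * ‖h s‖) ∧
          -- the same with the maximal domain, uniqueness being under (IP) or (B)
          IsMild (G.opA (fun r => -r) p) h u₀ T u ∧
          (G.CondIP ∨ G.CondB →
            ∀ v, IsMild (G.opA (fun r => -r) p) h u₀ T v → EqOn v u (timeInterval T)) := by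
  have hA := G.isMAccretive_opOmega hp hE hC
  refine ⟨hA.S, hA.isExpNeg, fun T hT u₀ h hh => ⟨hA.duhamel u₀ h, ?_⟩⟩
  have hi : ∀ t ∈ timeInterval T, IntervalIntegrable h volume 0 t := fun t ht =>
    intervalIntegrable_of_timeInterval hh ht
  have hmild := hA.isMild_duhamel u₀ hT hi
  exact ⟨hmild, fun v hv => hA.eqOn_duhamel_of_isMild hT hi hv,
    fun t ht => ⟨hA.intervalIntegrable_S (hi t ht) t, rfl⟩,
    fun t ht => hA.norm_duhamel_le ht.1 (hi t ht), hmild.mono fun _ _ h => h.1,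
    fun hIB v hv => hA.eqOn_duhamel_of_isMild hT hi
      (hv.mono fun _ _ h => G.opOmega_of_opA hp hE hIB h)⟩
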